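/- **Notation.** Let $K$ be a knot in $S^3$. *Quantum side.* $J_K(n)\in\mathbb Z[q^{\pm1}]$ ($n\ge 1$) is the colored Jones function: the Jones polynomial of the zero-framed knot $K$ colored with the $n$-dimensional irreducible representation of $\mathfrak{sl}_2$, normalized to be $1$ for the unknot. On functions $f:\{1,2,\dots\}\to\mathbb Q(q)$ let $(Qf)(n)=q^nf(n)$ and $(Ef)(n)=f(n+1)$. Let $\mathcal A=\mathbb Z[q^{\pm1}]\langle Q,E\rangle/(EQ=qQE)$, let $\mathcal I_K=\{P\in\mathcal A: PJ_K=0\}$, and let $\epsilon:\mathcal A\to\mathbb Z[E,Q]$ be the evaluation at $q=1$. The characteristic variety is $$\mathrm{ch}(K)=\{(x,y)\in(\mathbb C^\star)^2: P(x,y)=0\text{ for all }P\in\epsilon(\mathcal I_K)\},\qquad (x,y)=(E,Q).$$ Let $\mathcal A_{\mathrm{loc}}=\mathbb Q(q,Q)[E;\sigma]$, $\sigma(f)(q,Q)=f(q,qQ)$, act on functions modulo functions that vanish at all but finitely many $n$. An $A_q$-polynomial $A_q(K)=\sum_k a_kE^k$ is a generator of the left ideal $\{P\in\mathcal A_{\mathrm{loc}}:PJ_K=0\}$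 with coprime coefficients $a_k\in\mathbb Z[q,Q]$ (and is $0$ if this ideal is $0$). *Geometric side.* With $\mu,\lambda$ the meridian and the (null-homologous) longitude of $K$, the deformation variety $D(K)\subset(\mathbb C^\star)^2$ is the set of all pairs $(L,M)$ of upper left entries of $\rho(\lambda),\rho(\mu)$, where $\rho$ runs over the homomorphisms $\pi_1(S^3\setminus K)\to \mathrm{SL}_2(\mathbb C)$ such that $\rho(\lambda),\rho(\mu)$ are upper triangular. The pair $(L,M^2)$ is identified with $(E,Q)$. An $A$-polynomial $A(K)\in\mathbb Z[L,M]$ is a primitive integral polynomial that generates the ideal in $\mathbb C[L,M]$ of the one-dimensional part of the Zariski closure of $D(K)$ (it is unique up to sign, and includes the factor $L-1$). *Essential equality.* For an algebraic set $V\subset\mathbb C^2$ let $V_1$ be the union of its one-dimensional irreducible components. Two subsets of $\mathbb C^2$ with Zariski closures $V,V'$ are essentially equal if there are finite unions $F,F'$ of lines $\{y=a\}$ with $V_1\cup F=V_1'\cup F'$. Two polynomials $f,g$ in two variables $(x,y)$ with integer coefficients are essentially equal if $c(y)f=d(y)g$ for some nonzero $c,d\in\mathbb Z[y]$. Let $V(f)\subset\mathbb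 C^2$ be the zero set of $f$. *The conjectures.* The AJ Conjecture for $K$ says that $A(K)(L,M)=\epsilon A_q(K)(L,M^2)$, where equality is up to nonzero rational functions of $M$, i.e. the two sides are essentially equal polynomials. The Characteristic-equals-Deformation Variety Conjecture for $K$ says that $\mathrm{ch}(K)$ and $D(K)$, the latter in the coordinates $(L,M^2)$, are essentially equal. **Lemma.** 1. The AJ Conjecture (for all knots) implies the Characteristic-equals-Deformation Variety Conjecture (for all knots). 2. Moreover the implication holds for each single knot $K$. 3. For every knot $K$ and every $A_q$-polynomial $A_q(K)$, the characteristic variety $\mathrm{ch}(K)$ is essentially equal to $V(\epsilon A_q(K))\cap(\mathbb C^\star)^2$. 4. For every knot $K$ and every $A$-polynomial $A(K)$, the deformation variety $D(K)$, in the coordinates $(L,M)$, is essentially equal to $V(A(K))$. 5. If $f,g\in\mathbb Z[E,Q]$ are essentially equal, then $V(f)$ and $V(g)$ are essentially equal. -/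

import Mathlib

open Polynomial

noncomputable section

namespace AJ

/-! ## Knots

By Alexander's theorem every (oriented) knot in the 3-sphere is the closure of a braid, so a knot
is given here by a braid word whose closure is connected.  Its group, its peripheral pair
(meridian, longitude) and its colored Jones function are computed from the closed braid diagram. -/

/-- A letter `(i, true)` of a braid word is the positive crossing of the strands in positions `i`
and `i + 1`, in which the strand that goes from position `i` to position `i + 1` passes over the
other one.  A letter `(i, false)` is the inverse crossing. -/
abbrev BraidWord (n : ℕ) := List (Fin n × Bool)

namespace BraidWord

variable {n : ℕ}

/-- The strand that starts in position `p` ends in position `perm w p`. -/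
def perm (w : BraidWord n) : Equiv.Perm (Fin (n + 1)) :=
  w.foldl (fun π c => Equiv.swap c.1.castSucc c.1.succ * π) 1

/-- The number of positive crossings minus the number of negative crossings. -/
def writhe (w : BraidWord n) : ℤ :=
  (w.map fun c => if c.2 then (1 : ℤ) else -1).sum

/-- Effect of one crossing on the pairs (meridian of the strand, product of what the longitude
has picked up along the strand so far), listed by position.  When a strand with meridian `b` passes
under a strand with meridian `a` at a crossing of sign `e`, then `b` becomes `a⁻ᵉ b aᵉ`, and the
longitude picks up the factor `aᵉ` (Wirtinger). -/
def crossing {G : Type*} [Group G] (s : Fin (n + 1) → G × G) (c : Fin n × Bool) :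
    Fin (n + 1) → G × G :=
  let l := s c.1.castSucc
  let r := s c.1.succ
  if c.2 then
    Function.update (Function.update s c.1.castSucc (l.1⁻¹ * r.1 * l.1, r.2 * l.1)) c.1.succ l
  else
    Function.update (Function.update s c.1.castSucc r) c.1.succ (r.1 * l.1 * r.1⁻¹, l.2 * r.1⁻¹)

/-- The data of the strands at the end of the braid, in terms of the free generators, which are
the meridians of the strands at its beginning. -/
def final (w : BraidWord n) : Fin (n + 1) → FreeGroup (Fin (n + 1)) × FreeGroup (Fin (n + 1)) :=
  w.foldl crossing fun p => (FreeGroup.of p, 1)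

end BraidWord

/-- A knot in the 3-sphere, as the closure of a braid with `n + 1` strands that is connected. -/
structure Knot where
  n : ℕ
  word : BraidWord n
  connected : word.perm.IsCycleOn Set.univ

namespace Knot

variable (K : Knot)

/-- The relations identify the meridians at the end of the braid with those at its beginning. -/
def relations : Set (FreeGroup (Fin (K.n + 1))) :=
  Set.range fun p => (K.word.final p).1 * (FreeGroup.of p)⁻¹

/-- The fundamental group of the knot complement, by its Wirtinger presentation. -/
abbrev Group : Type := PresentedGroup K.relations

/-- The meridian of the strand that starts in position `0`. -/
def meridian : K.Group := PresentedGroup.of 0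

/-- The parallel of the knot given by the plane of the diagram: follow the knot once around, from
position `0` on, and multiply the contributions of the `n + 1` strands in this order. -/
def blackboardLongitude : K.Group :=
  PresentedGroup.mk K.relations
    ((List.range (K.n + 1)).map fun t => (K.word.final ((K.word.perm ^ (t + 1)) 0)).2).prod

/-- The longitude that has linking number zero with the knot. -/
def longitude : K.Group := K.blackboardLongitude * K.meridian ^ (-K.word.writhe)

end Knot

/-! ## The colored Jones function -/

/-- Laurent polynomials in the variable `q` (which is `T 1`). -/
abbrev Zq := LaurentPolynomial ℤ

/-- The power `q ^ m`. -/
abbrev qpow (m : ℤ) : Zq := LaurentPolynomial.T m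

/-- The Gaussian binomial coefficient. -/
def qbinom : ℕ → ℕ → Zq
  | _, 0 => 1
  | 0, _ + 1 => 0
  | a + 1, b + 1 => qbinom a b + qpow (b + 1) * qbinom a (b + 1)

/-- The product of `q ^ m - 1` over `a < m ≤ a + k`. -/
def qrising (a k : ℕ) : Zq := ∏ t ∈ Finset.range k, (qpow (a + t + 1) - 1)

/-- Entry of the R-matrix of the irreducible `sl_2`-module with basis `e_0, …, e_d`, from
`e_i ⊗ e_j` to `e_k ⊗ e_l`, for a positive crossing. -/
def rMatrix (d i j k l : ℕ) : Zq :=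
  if i + j = k + l ∧ i ≤ l then
    let m : ℕ := l - i
    qpow ((i : ℤ) * j - d * j - m * i + m * j - (m * (m + 1) / 2 : ℕ)) *
      qbinom l m * qrising (d - j) m
  else 0

/-- Entry of the inverse of the R-matrix, for a negative crossing. -/
def rMatrixInv (d i j k l : ℕ) : Zq :=
  if i + j = k + l ∧ j ≤ k then
    let m : ℕ := k - j
    (-1) ^ m * qpow (-((i : ℤ) * j) + d * l) * qbinom k m * qrising (d - i) m
  else 0

/-- The operator of a crossing on the tensor power with `n + 1` factors, as a matrix whose rows
are the labels before the crossing and whose columns are the labels after it. -/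
def crossingMatrix (d : ℕ) {n : ℕ} (c : Fin n × Bool) :
    Matrix (Fin (n + 1) → Fin (d + 1)) (Fin (n + 1) → Fin (d + 1)) Zq :=
  Matrix.of fun s t =>
    if ∀ p, p ≠ c.1.castSucc → p ≠ c.1.succ → s p = t p then
      (if c.2 then rMatrix else rMatrixInv) d
        (s c.1.castSucc) (s c.1.succ) (t c.1.castSucc) (t c.1.succ)
    else 0

/-- The knot colored with the irreducible `sl_2`-module of dimension `d + 1`: the partial quantum
trace, over all factors but the first, of the braid operator.  It is a multiple of the identity of
the first factor, which is read off at `e_0`; so the unknot has the value `1`.  The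
exponent of the prefactor, in which the division is exact, corrects the framing to zero and takes
account of the half-integral powers of `q` that are omitted in the R-matrix and in the trace. -/
def coloredJonesAux (K : Knot) (d : ℕ) : Zq :=
  qpow (-(d * ((K.word.writhe + K.n) / 2))) *
    ∑ s : Fin (K.n + 1) → Fin (d + 1),
      if s 0 = 0 then
        qpow (∑ p : Fin K.n, ((s p.succ : ℕ) : ℤ)) * (K.word.map (crossingMatrix d)).prod s s
      else 0

/-- The field of rational functions of `q` with rational coefficients. -/
abbrev Qq := RatFunc ℚ

/-- Laurent polynomials as rational functions. -/
def toQq : Zq →+* Qq :=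
  LaurentPolynomial.eval₂ (Int.castRingHom Qq) (Units.mk0 RatFunc.X RatFunc.X_ne_zero)

/-- The colored Jones function: its value at `n ≥ 1` is the Jones polynomial of the knot colored
with the `n`-dimensional irreducible module.  Discrete functions are defined on `{1, 2, …}`, and
their value at `0` is never used. -/
def coloredJones (K : Knot) (n : ℕ) : Qq := toQq (coloredJonesAux K (n - 1))

/-! ## The q-Weyl algebra, the recursion ideal and the characteristic variety -/

/-- The endomorphism `Q ↦ q Q` of `ℤ[q, q⁻¹][Q]`. -/
def shiftZ : Zq[X] →+* Zq[X] := Polynomial.compRingHom (C (qpow 1) * X)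

instance : MulSemiringAction (Multiplicative ℕ) Zq[X] :=
  MulSemiringAction.compHom _ (powersHom (Zq[X] →+* Zq[X]) shiftZ)

/-- The q-Weyl algebra `ℤ[q, q⁻¹]⟨Q, E⟩ / (E Q = q Q E)`: its elements are the finite sums
`∑ aₖ Eᵏ` with `aₖ ∈ ℤ[q, q⁻¹][Q]`, multiplied by the rule `E a(q, Q) = a(q, q Q) E`. -/
abbrev WeylAlgebra := SkewPolynomial Zq[X]

namespace WeylAlgebra

/-- The operator `E`. -/
def E : WeylAlgebra := SkewPolynomial.X

/-- The operator `Q`. -/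
def Q : WeylAlgebra := SkewPolynomial.C X

/-- The scalar `q`. -/
def q : WeylAlgebra := SkewPolynomial.C (C (qpow 1))

theorem E_mul_Q : E * Q = q * Q * E := by
  have h : ((Multiplicative.ofAdd 1 : Multiplicative ℕ) • (X : Zq[X])) = C (qpow 1) * X := by
    change (powersHom (Zq[X] →+* Zq[X]) shiftZ (Multiplicative.ofAdd 1)) X = _
    simp [shiftZ]
  rw [E, Q, q, ← SkewPolynomial.C_mul, SkewPolynomial.C_mul_X_eq_monomial]
  rw [SkewPolynomial.X, ← SkewPolynomial.monomial_zero_left,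
    SkewPolynomial.monomial_mul_monomial]
  simp only [Function.iterate_one, add_zero, one_mul]
  rw [← h]
  rfl

/-- The action on discrete functions, `(Q f)(n) = qⁿ f(n)` and `(E f)(n) = f(n + 1)`. -/
def act (P : WeylAlgebra) (f : ℕ → Qq) (n : ℕ) : Qq :=
  P.sum fun k a => a.eval₂ toQq (RatFunc.X ^ n) * f (n + k)

/-- Evaluation at `q = 1`; the variables `0` and `1` of the polynomial ring are `E` and `Q`. -/
def epsilon (P : WeylAlgebra) : MvPolynomial (Fin 2) ℤ :=
  P.sum fun k a =>
    a.eval₂ (LaurentPolynomial.eval₂ MvPolynomial.C 1) (MvPolynomial.X 1) * MvPolynomial.X 0 ^ k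

end WeylAlgebra

/-- The recursion ideal of a discrete function in the q-Weyl algebra. -/
def recursionIdeal (f : ℕ → Qq) : Set WeylAlgebra := {P | ∀ n, 1 ≤ n → P.act f n = 0}

/-- The torus of pairs of nonzero complex numbers, in the affine plane. -/
def torus : Set (Fin 2 → ℂ) := {p | p 0 ≠ 0 ∧ p 1 ≠ 0}

/-- The characteristic variety of a left ideal, in the plane with coordinates `(E, Q)`. -/
def characteristicVariety (I : Set WeylAlgebra) : Set (Fin 2 → ℂ) :=
  {p | p ∈ torus ∧ ∀ P ∈ I, MvPolynomial.aeval p P.epsilon = 0}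

/-- The characteristic variety of a knot. -/
def Knot.charVariety (K : Knot) : Set (Fin 2 → ℂ) :=
  characteristicVariety (recursionIdeal (coloredJones K))

/-! ## The noncommutative A-polynomial -/

/-- The field `ℚ(q, Q)`, as the field of rational functions of `Q` over `ℚ(q)`. -/
abbrev QqQ := RatFunc Qq

/-- The endomorphism `f(q, Q) ↦ f(q, q Q)` of polynomials. -/
def shiftPoly : Qq[X] →+* Qq[X] := Polynomial.compRingHom (C RatFunc.X * X)

theorem shiftPoly_injective : Function.Injective shiftPoly := by
  rw [injective_iff_map_eq_zero]
  intro p hp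
  have hp' : p.comp (C RatFunc.X * X) = 0 := hp
  rcases Polynomial.comp_eq_zero_iff.1 hp' with h | ⟨_, h⟩
  · exact h
  · have := congrArg (fun r : Qq[X] => r.coeff 1) h
    simp [RatFunc.X_ne_zero] at this

/-- The automorphism `σ(f)(q, Q) = f(q, q Q)` of `ℚ(q, Q)`. -/
def sigma : QqQ →+* QqQ :=
  RatFunc.mapRingHom shiftPoly
    (nonZeroDivisors_le_comap_nonZeroDivisors_of_injective _ shiftPoly_injective)

instance : MulSemiringAction (Multiplicative ℕ) QqQ :=
  MulSemiringAction.compHom _ (powersHom (QqQ →+* QqQ) sigma)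

/-- The Ore algebra of finite sums `∑ aₖ Eᵏ` with `aₖ ∈ ℚ(q, Q)`, in which
`a Eᵏ * b Eˡ = a σᵏ(b) Eᵏ⁺ˡ`. -/
abbrev OreAlgebra := SkewPolynomial QqQ

/-- The embedding of the q-Weyl algebra in the Ore algebra. -/
def WeylAlgebra.toOre (P : WeylAlgebra) : OreAlgebra :=
  P.sum fun k a => SkewPolynomial.monomial k (a.eval₂ (RatFunc.C.comp toQq) RatFunc.X)

/-- The recursion ideal of a discrete function in the Ore algebra, which acts on discrete functions
up to finitely many values: a rational function `a(q, Q)` acts by the value `a(q, qⁿ)`, which is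
defined for all but finitely many `n`. -/
def oreRecursionIdeal (f : ℕ → Qq) : Set OreAlgebra :=
  {R | ∀ᶠ n in Filter.atTop,
    (R.sum fun k a => RatFunc.eval (RingHom.id Qq) (RatFunc.X ^ n) a * f (n + k)) = 0}

/-- `P` is an `A_q`-polynomial of the left ideal `I` of the Ore algebra: it lies in the q-Weyl
algebra, it generates `I` (so its degree in `E` is minimal), and its coefficients are coprime
elements of `ℤ[q, Q]` (unless `I` vanishes, when it is `0`). -/
def IsAqPolynomial (I : Set OreAlgebra) (P : WeylAlgebra) : Prop :=
  (∀ R, R ∈ I ↔ ∃ S : OreAlgebra, R = S * P.toOre) ∧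
  ∃ a : ℕ → ℤ[X][X],
    (∀ k, P.coeff k = (a k).map Polynomial.toLaurent) ∧
    (P ≠ 0 → ∀ d : ℤ[X][X], (∀ k, d ∣ a k) → IsUnit d)

/-- `P` is an `A_q`-polynomial of the knot `K`. -/
def Knot.IsAqPolynomial (K : Knot) (P : WeylAlgebra) : Prop :=
  AJ.IsAqPolynomial (oreRecursionIdeal (coloredJones K)) P

/-! ## Plane algebraic sets -/

/-- The Zariski closure in the affine plane. -/
def zariskiClosure (S : Set (Fin 2 → ℂ)) : Set (Fin 2 → ℂ) :=
  MvPolynomial.zeroLocus ℂ (MvPolynomial.vanishingIdeal ℂ S)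

/-- The union of the irreducible components of dimension `i` of an algebraic set. -/
def pureDimPart (i : ℕ) (V : Set (Fin 2 → ℂ)) : Set (Fin 2 → ℂ) :=
  ⋃ P ∈ {P ∈ (MvPolynomial.vanishingIdeal ℂ V).minimalPrimes |
      ringKrullDim (MvPolynomial (Fin 2) ℂ ⧸ P) = i},
    MvPolynomial.zeroLocus ℂ P

/-- The union of the lines `y = a` with `a` in a finite set. -/
def yLines (F : Finset ℂ) : Set (Fin 2 → ℂ) := {p | p 1 ∈ F}

/-- The one-dimensional parts of the closures agree up to finitely many lines `y = a`. -/
def EssentiallyEqual (V W : Set (Fin 2 → ℂ)) : Prop :=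
  ∃ F G : Finset ℂ, pureDimPart 1 (zariskiClosure V) ∪ yLines F =
    pureDimPart 1 (zariskiClosure W) ∪ yLines G

/-- The complex zeros of an integral polynomial in two variables. -/
def zeros (f : MvPolynomial (Fin 2) ℤ) : Set (Fin 2 → ℂ) := {p | MvPolynomial.aeval p f = 0}

/-- The quotient of `f` and `g` is a nonzero rational function of the second variable. -/
def EssentiallyEqualPoly (f g : MvPolynomial (Fin 2) ℤ) : Prop :=
  ∃ c d : ℤ[X], c ≠ 0 ∧ d ≠ 0 ∧
    Polynomial.aeval (MvPolynomial.X 1) c * f = Polynomial.aeval (MvPolynomial.X 1) d * g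

/-! ## The deformation variety and the A-polynomial -/

/-- The deformation variety, in the plane with coordinates `(L, M)`: the pairs of upper left
entries of the longitude and of the meridian, for all representations of the knot group in
`SL(2, ℂ)` that are upper triangular on the peripheral subgroup. -/
def Knot.deformationVariety (K : Knot) : Set (Fin 2 → ℂ) :=
  {p | ∃ ρ : K.Group →* Matrix.SpecialLinearGroup (Fin 2) ℂ,
    ρ K.longitude 1 0 = 0 ∧ ρ K.meridian 1 0 = 0 ∧
    p 0 = ρ K.longitude 0 0 ∧ p 1 = ρ K.meridian 0 0}

/-- The deformation variety in the coordinates `(L, M²)`, which are identified with `(E, Q)`. -/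
def Knot.deformationVarietySq (K : Knot) : Set (Fin 2 → ℂ) :=
  (fun p => ![p 0, p 1 ^ 2]) '' K.deformationVariety

/-- `A` is an A-polynomial of the knot `K`, in the variables `(L, M)`: a primitive integral
polynomial that generates the ideal of the one-dimensional part of the closure of the deformation
variety.  It is unique up to sign. -/
def Knot.IsAPolynomial (K : Knot) (A : MvPolynomial (Fin 2) ℤ) : Prop :=
  MvPolynomial.vanishingIdeal ℂ (pureDimPart 1 (zariskiClosure K.deformationVariety)) =
    Ideal.span {A.map (Int.castRingHom ℂ)} ∧
  ∀ c : ℤ, MvPolynomial.C c ∣ A → IsUnit c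

/-! ## The two conjectures -/

/-- The substitution of `(L, M²)` for `(E, Q)`. -/
def substSq (f : MvPolynomial (Fin 2) ℤ) : MvPolynomial (Fin 2) ℤ :=
  MvPolynomial.aeval ![MvPolynomial.X 0, MvPolynomial.X 1 ^ 2] f

/-- The AJ Conjecture for one knot, `A(K)(L, M) = ε A_q(K)(L, M²)`, where polynomials are compared
up to nonzero rational functions of `M`. -/
def AJFor (K : Knot) : Prop :=
  ∀ A P, K.IsAPolynomial A → K.IsAqPolynomial P → EssentiallyEqualPoly A (substSq P.epsilon)

/-- The AJ Conjecture. -/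
def AJConjecture : Prop := ∀ K : Knot, AJFor K

/-- The characteristic and the deformation variety of one knot are essentially equal. -/
def CharEqDefFor (K : Knot) : Prop := EssentiallyEqual K.charVariety K.deformationVarietySq

/-- The Characteristic equals Deformation Variety Conjecture. -/
def CharEqDefConjecture : Prop := ∀ K : Knot, CharEqDefFor K

end AJ

end

open Polynomial

noncomputable section

namespace AJ

/-! The one-dimensional part of the closure of `S` is encoded by the irreducible polynomials that
divide every element of the (nonzero) vanishing ideal of `S`. Essential equality means that these
curve factors agree apart from those of lines `y = a` (`essentiallyEqual_of_isCurveFactor_iff`,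
`EssentiallyEqual.isCurveFactor_iff`). It is therefore transitive, and it holds for two sets that
agree wherever some nonzero `c(y)` does not vanish (`essentiallyEqual_of_agree`). Claim 5 follows at
once, and claim 4 holds because the one-dimensional part is the zero set of its own ideal.

Claim 3 compares two ideals. An operator `R` that annihilates the colored Jones function is a left
multiple of `A_q` in the Ore algebra. After clearing denominators, powers of `q - 1` can be
cancelled: `ε A_q ≠ 0` by coprimality of the coefficients, and `ℤ[E, Q]` is a domain. Setting `q =
1` shows that `ε A_q` divides `c(Q) ε R` with `c ≠ 0` (`exists_mul_epsilon_eq`), and noetherianity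
makes `c` uniform in `R`. Conversely, `A_q` annihilates the function for large `n`, and a factor `∏
(Q - q ^ j)` repairs the remaining values at the cost of a power of `Q - 1` in `ε`.

For claims 1 and 2, the AJ Conjecture identifies the components of `D(K)` with those of the pullback
of `ε A_q` under `(L, M) ↦ (L, M²)`. A norm argument for this double covering
(`isCurveFactor_sqMap_image`) pushes the identification down. Since the conjecture speaks of every
`A` and every `A_q`, both must be shown to exist: `A` by descent along the automorphisms of `ℂ`, and
`A_q` by right division in the Ore algebra. -/

/-! ### One-dimensional components of plane algebraic sets -/

/-- `f` is an equation of a one-dimensional component of the closure of `S`. -/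
def IsCurveFactor (S : Set (Fin 2 → ℂ)) (f : MvPolynomial (Fin 2) ℂ) : Prop :=
  Irreducible f ∧ MvPolynomial.vanishingIdeal ℂ S ≠ ⊥ ∧
    ∀ h ∈ MvPolynomial.vanishingIdeal ℂ S, f ∣ h

theorem vanishingIdeal_zariskiClosure (S : Set (Fin 2 → ℂ)) :
    MvPolynomial.vanishingIdeal ℂ (zariskiClosure S) = MvPolynomial.vanishingIdeal ℂ S :=
  le_antisymm (MvPolynomial.vanishingIdeal_anti_mono (MvPolynomial.zeroLocus_vanishingIdeal_le S))
    (MvPolynomial.le_vanishingIdeal_zeroLocus _)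

theorem ringKrullDim_plane : ringKrullDim (MvPolynomial (Fin 2) ℂ) = 2 := by
  simp [MvPolynomial.ringKrullDim_of_isNoetherianRing]

theorem mem_zeroLocus_span_singleton {f : MvPolynomial (Fin 2) ℂ} {p : Fin 2 → ℂ} :
    p ∈ MvPolynomial.zeroLocus ℂ (Ideal.span {f}) ↔ MvPolynomial.aeval p f = 0 := by
  simp [MvPolynomial.zeroLocus_span]

/-- This is the Nullstellensatz for the prime ideal `(f)`. -/
theorem dvd_of_forall_zero {f h : MvPolynomial (Fin 2) ℂ} (hf : Irreducible f)
    (H : ∀ p : Fin 2 → ℂ, MvPolynomial.aeval p f = 0 → MvPolynomial.aeval p h = 0) : f ∣ h := by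
  have hp : (Ideal.span {f}).IsPrime := (Ideal.span_singleton_prime hf.ne_zero).2 hf.prime
  rw [← Ideal.mem_span_singleton, ← MvPolynomial.IsPrime.vanishingIdeal_zeroLocus (K := ℂ)
    (Ideal.span {f})]
  exact fun p hp => H p (mem_zeroLocus_span_singleton.1 hp)

theorem irreducible_X_sub_C (i : Fin 2) (a : ℂ) :
    Irreducible (MvPolynomial.X i - MvPolynomial.C a : MvPolynomial (Fin 2) ℂ) := by
  have h0 : (MvPolynomial.X i - MvPolynomial.C a : MvPolynomial (Fin 2) ℂ).totalDegree = 1 := by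
    rw [sub_eq_add_neg, MvPolynomial.totalDegree_add_eq_left_of_totalDegree_lt]
    · simp
    · rw [← MvPolynomial.C_neg]; simp
  apply MvPolynomial.irreducible_of_totalDegree_eq_one h0
  intro x hx
  have h1 := hx (Finsupp.single i 1)
  have h2 : MvPolynomial.coeff (Finsupp.single i 1)
      (MvPolynomial.X i - MvPolynomial.C a : MvPolynomial (Fin 2) ℂ) = 1 := by
    have h3 : (0 : Fin 2 →₀ ℕ) ≠ Finsupp.single i 1 := by simp [eq_comm]
    simp [MvPolynomial.coeff_C, h3]
  rw [h2] at h1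
  exact isUnit_of_dvd_one h1

/-- A maximal ideal is the ideal of a point `x`, so a single generator would be associated to both
`X 0 - x 0` and `X 1 - x 1`. -/
theorem not_isMaximal_span_singleton (f : MvPolynomial (Fin 2) ℂ) :
    ¬ (Ideal.span {f}).IsMaximal := by
  intro h
  obtain ⟨x, hx⟩ := MvPolynomial.isMaximal_iff_eq_vanishingIdeal_singleton.1 h
  have hd : ∀ i, f ∣ (MvPolynomial.X i - MvPolynomial.C (x i)) := fun i => by
    rw [← Ideal.mem_span_singleton, hx, MvPolynomial.mem_vanishingIdeal_singleton_iff]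
    simp
  have hu : ¬ IsUnit f := fun hu => h.ne_top (Ideal.span_singleton_eq_top.2 hu)
  have ha : ∀ i, Associated f (MvPolynomial.X i - MvPolynomial.C (x i)) := fun i =>
    ((irreducible_X_sub_C i (x i)).dvd_iff.1 (hd i)).resolve_left hu |>.symm
  have h01 := ((ha 0).symm.trans (ha 1)).dvd
  obtain ⟨k, hk⟩ := h01
  -- At this point `X 0 - x 0` vanishes while `X 1 - x 1` takes the value `1`.
  have := congrArg (MvPolynomial.aeval ![x 0, x 1 + 1]) hk
  simp at this

theorem ringKrullDim_quotient_add_one_le {P : Ideal (MvPolynomial (Fin 2) ℂ)}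
    {f : MvPolynomial (Fin 2) ℂ} (hf : f ≠ 0) (h : f ∈ P) :
    ringKrullDim (MvPolynomial (Fin 2) ℂ ⧸ P) ≤ 1 := by
  have := ringKrullDim_succ_le_of_surjective (Ideal.Quotient.mk P) Ideal.Quotient.mk_surjective
    (mem_nonZeroDivisors_of_ne_zero hf) (Ideal.Quotient.eq_zero_iff_mem.2 h)
  rw [ringKrullDim_plane, show (2 : WithBot ℕ∞) = 1 + 1 by norm_num] at this
  exact (ENat.WithBot.add_le_add_one_right_iff).1 this

theorem ringKrullDim_quotient_span_irreducible {f : MvPolynomial (Fin 2) ℂ} (hf : Irreducible f) :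
    ringKrullDim (MvPolynomial (Fin 2) ℂ ⧸ Ideal.span {f}) = 1 := by
  have hp : (Ideal.span {f}).IsPrime := (Ideal.span_singleton_prime hf.ne_zero).2 hf.prime
  refine le_antisymm
    (ringKrullDim_quotient_add_one_le hf.ne_zero (Ideal.mem_span_singleton_self f)) ?_
  by_contra hlt
  rw [not_le] at hlt
  have h0 : Ring.KrullDimLE 0 (MvPolynomial (Fin 2) ℂ ⧸ Ideal.span {f}) := by
    rw [Ring.krullDimLE_iff]
    exact ENat.WithBot.lt_add_one_iff.1 (by simpa using hlt)
  have hm : (⊥ : Ideal (MvPolynomial (Fin 2) ℂ ⧸ Ideal.span {f})).IsMaximal :=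
    Ring.krullDimLE_zero_iff.1 h0 ⊥ Ideal.isPrime_bot
  exact not_isMaximal_span_singleton f (Ideal.bot_quotient_isMaximal_iff _ |>.1 hm)

/-- A nonzero prime `P` contains a prime element `f`. An element of `P` outside `(f)` would be a
nonzerodivisor modulo `f`, and dividing by it would push the dimension below that of the quotient by
`(f)`, which is already `1`. -/
theorem eq_span_of_ringKrullDim_eq_one {P : Ideal (MvPolynomial (Fin 2) ℂ)} [P.IsPrime]
    (h : ringKrullDim (MvPolynomial (Fin 2) ℂ ⧸ P) = 1) :
    ∃ f, Irreducible f ∧ P = Ideal.span {f} := by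
  have hP : P ≠ ⊥ := by
    rintro rfl
    rw [ringKrullDim_eq_of_ringEquiv (RingEquiv.quotientBot _), ringKrullDim_plane] at h
    norm_num at h
  obtain ⟨f, hfP, hf⟩ := Ideal.IsPrime.exists_mem_prime_of_ne_bot ‹_› hP
  refine ⟨f, hf.irreducible, le_antisymm (fun g hg => ?_)
    ((Ideal.span_singleton_le_iff_mem _).2 hfP)⟩
  by_contra hgf
  have hp : (Ideal.span {f}).IsPrime := (Ideal.span_singleton_prime hf.ne_zero).2 hf
  have hle : Ideal.span {f} ≤ P := (Ideal.span_singleton_le_iff_mem _).2 hfP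
  have h1 := ringKrullDim_succ_le_of_surjective (Ideal.Quotient.factor hle)
    (Ideal.Quotient.factor_surjective hle) (r := Ideal.Quotient.mk _ g)
    (mem_nonZeroDivisors_of_ne_zero (fun h0 => hgf (Ideal.Quotient.eq_zero_iff_mem.1 h0)))
    (by simpa using Ideal.Quotient.eq_zero_iff_mem.2 hg)
  rw [h, ringKrullDim_quotient_span_irreducible hf.irreducible] at h1
  norm_num at h1

/-- Primes with one-dimensional quotient are principal, so the relevant minimal primes are given by
irreducible polynomials. The zero vanishing ideal has to be excluded from `IsCurveFactor` because
every `f` divides `0`. -/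
theorem mem_pureDimPart_one {S : Set (Fin 2 → ℂ)} {p : Fin 2 → ℂ} :
    p ∈ pureDimPart 1 (zariskiClosure S) ↔
      ∃ f, IsCurveFactor S f ∧ MvPolynomial.aeval p f = 0 := by
  simp only [pureDimPart, vanishingIdeal_zariskiClosure, Set.mem_iUnion, exists_prop]
  constructor
  · rintro ⟨P, ⟨hP, hdim⟩, hp⟩
    have : P.IsPrime := hP.1.1
    obtain ⟨f, hf, rfl⟩ := eq_span_of_ringKrullDim_eq_one (by simpa using hdim)
    refine ⟨f, ⟨hf, ?_, fun h hh => Ideal.mem_span_singleton.1 (hP.1.2 hh)⟩,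
      mem_zeroLocus_span_singleton.1 hp⟩
    intro h0
    rw [h0] at hP
    have := hP.2 ⟨Ideal.isPrime_bot, le_rfl⟩ bot_le
    exact hf.ne_zero (by simpa using this)
  · rintro ⟨f, ⟨hf, h0, hd⟩, hp⟩
    refine ⟨Ideal.span {f}, ⟨⟨⟨(Ideal.span_singleton_prime hf.ne_zero).2 hf.prime,
      fun h hh => Ideal.mem_span_singleton.2 (hd h hh)⟩, ?_⟩,
      by simpa using ringKrullDim_quotient_span_irreducible hf⟩, mem_zeroLocus_span_singleton.2 hp⟩
    -- For minimality: a smaller prime is nonzero, hence contains a prime multiple of `f`, which is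
    -- associated to `f`.
    rintro Q ⟨hQ, hIQ⟩ hle
    have hQ0 : Q ≠ ⊥ := fun h => h0 (le_bot_iff.1 (h ▸ hIQ))
    obtain ⟨g, hgQ, hg⟩ := hQ.exists_mem_prime_of_ne_bot hQ0
    have : f ∣ g := Ideal.mem_span_singleton.1 (hle hgQ)
    have ha := hf.associated_of_dvd hg.irreducible this
    exact (Ideal.span_singleton_le_iff_mem _).2 (Q.mem_of_dvd ha.symm.dvd hgQ)

/-! ### Horizontal lines and essential equality -/

/-- `f` is an equation of a line `y = a`. -/
def IsHorizontal (f : MvPolynomial (Fin 2) ℂ) : Prop :=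
  ∃ a, Associated f (MvPolynomial.X 1 - MvPolynomial.C a)

theorem exists_irreducible_dvd_of_aeval_eq_zero {g : MvPolynomial (Fin 2) ℂ} (hg : g ≠ 0)
    {p : Fin 2 → ℂ} (hp : MvPolynomial.aeval p g = 0) :
    ∃ f, Irreducible f ∧ f ∣ g ∧ MvPolynomial.aeval p f = 0 := by
  induction g using WfDvdMonoid.induction_on_irreducible with
  | zero => exact absurd rfl hg
  | unit u hu =>
    exact absurd hp (hu.map (MvPolynomial.aeval p)).ne_zero
  | mul a i ha hi ih =>
    rw [map_mul, mul_eq_zero] at hp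
    rcases hp with hp | hp
    · exact ⟨i, hi, dvd_mul_right _ _, hp⟩
    · obtain ⟨f, h1, h2, h3⟩ := ih ha hp
      exact ⟨f, h1, h2.mul_left _, h3⟩

/-- The polynomial `g` is the gcd of finitely many generators of the vanishing ideal, or `1` if that
ideal is zero. -/
theorem exists_curve_equation (S : Set (Fin 2 → ℂ)) :
    ∃ g : MvPolynomial (Fin 2) ℂ, g ≠ 0 ∧ ∀ f, Irreducible f → (IsCurveFactor S f ↔ f ∣ g) := by
  by_cases h0 : MvPolynomial.vanishingIdeal ℂ S = ⊥
  · exact ⟨1, one_ne_zero, fun f hf => ⟨fun h => absurd h0 h.2.1,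
      fun h => absurd (isUnit_of_dvd_one h) hf.not_isUnit⟩⟩
  · obtain ⟨s, hs⟩ := (isNoetherianRing_iff_ideal_fg _).1 inferInstance
      (MvPolynomial.vanishingIdeal ℂ S)
    let := UniqueFactorizationMonoid.strongNormalizationMonoid (α := MvPolynomial (Fin 2) ℂ)
    let := UniqueFactorizationMonoid.toNormalizedGCDMonoid (MvPolynomial (Fin 2) ℂ)
    refine ⟨s.gcd id, fun h => h0 ?_, fun f hf => ?_⟩
    · rw [← hs, Ideal.span_eq_bot]
      exact fun x hx => Finset.gcd_eq_zero_iff.1 h x hx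
    · rw [Finset.dvd_gcd_iff]
      refine ⟨fun h x hx => h.2.2 x (hs ▸ Ideal.subset_span hx), fun h => ⟨hf, h0, fun x hx => ?_⟩⟩
      rw [← Ideal.mem_span_singleton]
      rw [← hs] at hx
      exact (Ideal.span_le.2 fun y hy => Ideal.mem_span_singleton.2 (h y hy)) hx

theorem exists_pureDimPart_one_eq (S : Set (Fin 2 → ℂ)) :
    ∃ g : MvPolynomial (Fin 2) ℂ, g ≠ 0 ∧ (∀ f, Irreducible f → (IsCurveFactor S f ↔ f ∣ g)) ∧
      ∀ p, p ∈ pureDimPart 1 (zariskiClosure S) ↔ MvPolynomial.aeval p g = 0 := by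
  obtain ⟨g, hg, h⟩ := exists_curve_equation S
  refine ⟨g, hg, h, fun p => mem_pureDimPart_one.trans ⟨?_, fun hp => ?_⟩⟩
  · rintro ⟨f, hf, hp⟩
    obtain ⟨k, rfl⟩ := (h f hf.1).1 hf
    rw [map_mul, hp, zero_mul]
  · obtain ⟨f, h1, h2, h3⟩ := exists_irreducible_dvd_of_aeval_eq_zero hg hp
    exact ⟨f, (h f h1).2 h2, h3⟩

/-- Restricted to a vertical line on which `g` is not identically zero, `g` becomes a nonzero
polynomial in one variable; every horizontal line in the curve gives one of its roots. -/
theorem exists_finset_of_horizontal {g : MvPolynomial (Fin 2) ℂ} (hg : g ≠ 0) :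
    ∃ F : Finset ℂ, ∀ a, MvPolynomial.X 1 - MvPolynomial.C a ∣ g → a ∈ F := by
  obtain ⟨x, hx⟩ : ∃ x : Fin 2 → ℂ, MvPolynomial.eval x g ≠ 0 := by
    by_contra! h
    exact hg (MvPolynomial.funext fun x => by simpa using h x)
  let u : ℂ[X] := MvPolynomial.aeval ![C (x 0), X] g
  have hu : ∀ b, u.eval b = MvPolynomial.eval ![x 0, b] g := fun b => by
    have : (Polynomial.evalRingHom b).comp
        (MvPolynomial.aeval ![C (x 0), X] : MvPolynomial (Fin 2) ℂ →ₐ[ℂ] ℂ[X]).toRingHom =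
        MvPolynomial.eval ![x 0, b] := by
      apply MvPolynomial.ringHom_ext
      · intro r; simp
      · intro i; fin_cases i <;> simp
    exact congrArg (fun φ => φ g) this
  refine ⟨u.roots.toFinset, fun a ⟨k, hk⟩ => ?_⟩
  have hu0 : u ≠ 0 := fun h => hx <| by
    rw [show x = ![x 0, x 1] by ext i; fin_cases i <;> rfl, ← hu, h]; simp
  simp [hu0, hu, hk]

theorem essentiallyEqual_of_isCurveFactor_iff {S S' : Set (Fin 2 → ℂ)}
    (h : ∀ f, Irreducible f → ¬ IsHorizontal f → (IsCurveFactor S f ↔ IsCurveFactor S' f)) :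
    EssentiallyEqual S S' := by
  obtain ⟨g, hg, hgS⟩ := exists_curve_equation S
  obtain ⟨g', hg', hgS'⟩ := exists_curve_equation S'
  obtain ⟨F, hF⟩ := exists_finset_of_horizontal hg
  obtain ⟨F', hF'⟩ := exists_finset_of_horizontal hg'
  have key : ∀ (T T' : Set (Fin 2 → ℂ)) (k : MvPolynomial (Fin 2) ℂ) (G : Finset ℂ),
      (∀ f, Irreducible f → ¬ IsHorizontal f → (IsCurveFactor T f → IsCurveFactor T' f)) →
      (∀ f, Irreducible f → (IsCurveFactor T f ↔ f ∣ k)) →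
      (∀ a, MvPolynomial.X 1 - MvPolynomial.C a ∣ k → a ∈ G) →
      pureDimPart 1 (zariskiClosure T) ⊆ pureDimPart 1 (zariskiClosure T') ∪ yLines G := by
    intro T T' k G hT hk hG p hp
    obtain ⟨f, hf, hfp⟩ := mem_pureDimPart_one.1 hp
    by_cases hl : IsHorizontal f
    · obtain ⟨a, ha⟩ := hl
      right
      have : p 1 = a := by
        obtain ⟨c, hc⟩ := ha.dvd
        have := congrArg (MvPolynomial.aeval p) hc
        rw [map_mul, hfp, zero_mul] at this
        simpa [sub_eq_zero] using this
      rw [yLines, Set.mem_ofPred_eq, this]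
      exact hG a (ha.symm.dvd.trans ((hk f hf.1).1 hf))
    · exact Or.inl (mem_pureDimPart_one.2 ⟨f, hT f hf.1 hl hf, hfp⟩)
  classical
  refine ⟨F ∪ F', F ∪ F', Set.Subset.antisymm ?_ ?_⟩
  · refine Set.union_subset (key S S' g (F ∪ F') (fun f h1 h2 => (h f h1 h2).1) hgS
      fun a ha => Finset.mem_union_left _ (hF a ha)) Set.subset_union_right
  · refine Set.union_subset (key S' S g' (F ∪ F') (fun f h1 h2 => (h f h1 h2).2) hgS'
      fun a ha => Finset.mem_union_right _ (hF' a ha)) Set.subset_union_right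

/-- The inclusion makes `f` divide an equation of the curve part of `S'` times the equations of the
lines. Being prime and not horizontal, `f` divides the first factor. -/
theorem isCurveFactor_of_subset_union_yLines {S S' : Set (Fin 2 → ℂ)} {F : Finset ℂ}
    (h : pureDimPart 1 (zariskiClosure S) ⊆ pureDimPart 1 (zariskiClosure S') ∪ yLines F)
    {f : MvPolynomial (Fin 2) ℂ} (hl : ¬ IsHorizontal f) (hf : IsCurveFactor S f) :
    IsCurveFactor S' f := by
  obtain ⟨g, hg, hgS, hV⟩ := exists_pureDimPart_one_eq S'
  have : f ∣ g * ∏ a ∈ F, (MvPolynomial.X 1 - MvPolynomial.C a) := by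
    refine dvd_of_forall_zero hf.1 fun p hp => ?_
    rcases h (mem_pureDimPart_one.2 ⟨f, hf, hp⟩) with h | h
    · rw [map_mul, (hV p).1 h, zero_mul]
    · rw [map_mul, map_prod, Finset.prod_eq_zero h (by simp), mul_zero]
  rcases hf.1.prime.dvd_or_dvd this with h | h
  · exact (hgS f hf.1).2 h
  · obtain ⟨a, -, ha⟩ := hf.1.prime.exists_mem_finset_dvd h
    exact absurd ⟨a, hf.1.associated_of_dvd (irreducible_X_sub_C 1 a) ha⟩ hl

theorem EssentiallyEqual.isCurveFactor_iff {S S' : Set (Fin 2 → ℂ)} (h : EssentiallyEqual S S')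
    {f : MvPolynomial (Fin 2) ℂ} (hl : ¬ IsHorizontal f) :
    IsCurveFactor S f ↔ IsCurveFactor S' f := by
  obtain ⟨F, G, h⟩ := h
  exact ⟨isCurveFactor_of_subset_union_yLines (F := G) (h ▸ Set.subset_union_left) hl,
    isCurveFactor_of_subset_union_yLines (F := F) (h.symm ▸ Set.subset_union_left) hl⟩

theorem EssentiallyEqual.trans {S S' S'' : Set (Fin 2 → ℂ)} (h : EssentiallyEqual S S')
    (h' : EssentiallyEqual S' S'') : EssentiallyEqual S S'' :=
  essentiallyEqual_of_isCurveFactor_iff fun _ _ hl =>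
    (h.isCurveFactor_iff hl).trans (h'.isCurveFactor_iff hl)

/-- Multiplication by `u` carries the vanishing ideal of either set into that of the other, and the
prime `f` can be cancelled against `u`. -/
theorem IsCurveFactor.of_agree {S S' : Set (Fin 2 → ℂ)} {u : MvPolynomial (Fin 2) ℂ} (hu : u ≠ 0)
    (h : ∀ p, MvPolynomial.aeval p u ≠ 0 → (p ∈ S ↔ p ∈ S')) {f : MvPolynomial (Fin 2) ℂ}
    (hfu : ¬ f ∣ u) (hf : IsCurveFactor S f) : IsCurveFactor S' f := by
  have hmem : ∀ {T T' : Set (Fin 2 → ℂ)},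
      (∀ p, MvPolynomial.aeval p u ≠ 0 → (p ∈ T' → p ∈ T)) → ∀ k ∈ MvPolynomial.vanishingIdeal ℂ T,
      u * k ∈ MvPolynomial.vanishingIdeal ℂ T' := by
    intro T T' hT k hk p hp
    by_cases h0 : MvPolynomial.aeval p u = 0
    · rw [map_mul, h0, zero_mul]
    · rw [map_mul, hk p (hT p h0 hp), mul_zero]
  refine ⟨hf.1, ?_, fun k hk => ?_⟩
  · obtain ⟨k, hk, hk0⟩ := Submodule.exists_mem_ne_zero_of_ne_bot hf.2.1
    exact (Submodule.ne_bot_iff _).2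
      ⟨u * k, hmem (fun p hp => (h p hp).2) k hk, mul_ne_zero hu hk0⟩
  · exact (hf.1.prime.dvd_or_dvd
      (hf.2.2 _ (hmem (fun p hp => (h p hp).1) k hk))).resolve_left hfu

theorem isCurveFactor_iff_of_agree {S S' : Set (Fin 2 → ℂ)} {u : MvPolynomial (Fin 2) ℂ}
    (hu : u ≠ 0) (h : ∀ p, MvPolynomial.aeval p u ≠ 0 → (p ∈ S ↔ p ∈ S'))
    {f : MvPolynomial (Fin 2) ℂ} (hfu : ¬ f ∣ u) : IsCurveFactor S f ↔ IsCurveFactor S' f :=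
  ⟨.of_agree hu h hfu, .of_agree hu (fun p hp => (h p hp).symm) hfu⟩

/-- Over `ℂ` the polynomial `c` splits into linear factors `y - a`. -/
theorem isHorizontal_of_dvd_aeval_X {f : MvPolynomial (Fin 2) ℂ} (hf : Irreducible f) {c : ℂ[X]}
    (hc : c ≠ 0) (h : f ∣ Polynomial.aeval (MvPolynomial.X 1) c) : IsHorizontal f := by
  rw [(IsAlgClosed.splits c).eq_prod_roots, map_mul, Polynomial.aeval_C,
    map_multiset_prod, Multiset.map_map] at h
  rcases hf.prime.dvd_or_dvd h with h | h
  · refine absurd (isUnit_of_dvd_unit h ?_) hf.not_isUnit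
    exact (IsUnit.mk0 _ (leadingCoeff_ne_zero.2 hc)).map _
  · obtain ⟨k, hk, hd⟩ := hf.prime.exists_mem_multiset_dvd h
    obtain ⟨a, -, rfl⟩ := Multiset.mem_map.1 hk
    refine ⟨a, hf.associated_of_dvd (irreducible_X_sub_C 1 a) ?_⟩
    simpa using hd

theorem aeval_X_ne_zero {c : ℂ[X]} (hc : c ≠ 0) :
    (Polynomial.aeval (MvPolynomial.X 1 : MvPolynomial (Fin 2) ℂ)) c ≠ 0 := by
  have h := MvPolynomial.transcendental_X (σ := Fin 2) (R := ℂ) 1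
  exact fun h0 => hc ((transcendental_iff.1 h) c h0)

theorem essentiallyEqual_of_agree {S S' : Set (Fin 2 → ℂ)} {c : ℂ[X]} (hc : c ≠ 0)
    (h : ∀ p : Fin 2 → ℂ, c.eval (p 1) ≠ 0 → (p ∈ S ↔ p ∈ S')) : EssentiallyEqual S S' := by
  refine essentiallyEqual_of_isCurveFactor_iff fun f hf hl =>
    isCurveFactor_iff_of_agree (aeval_X_ne_zero hc) (fun p hp => h p ?_)
      fun hd => hl (isHorizontal_of_dvd_aeval_X hf hc hd)
  rwa [← Polynomial.aeval_algHom_apply, MvPolynomial.aeval_X, Polynomial.coe_aeval_eq_eval] at hp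

/-! ### Plane curves and zero sets of integral polynomials -/

/-- The plane curve with equation `A`. -/
def curve (A : MvPolynomial (Fin 2) ℂ) : Set (Fin 2 → ℂ) := {p | MvPolynomial.aeval p A = 0}

theorem isCurveFactor_curve {A : MvPolynomial (Fin 2) ℂ} (hA : A ≠ 0)
    {f : MvPolynomial (Fin 2) ℂ} : IsCurveFactor (curve A) f ↔ Irreducible f ∧ f ∣ A := by
  have hmem : A ∈ MvPolynomial.vanishingIdeal ℂ (curve A) := fun p hp => hp
  refine ⟨fun h => ⟨h.1, h.2.2 _ hmem⟩, fun ⟨hf, hd⟩ =>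
    ⟨hf, (Submodule.ne_bot_iff _).2 ⟨A, hmem, hA⟩, fun k hk => dvd_of_forall_zero hf
      fun p hp => hk p ?_⟩⟩
  obtain ⟨m, rfl⟩ := hd
  change MvPolynomial.aeval p (f * m) = 0
  rw [map_mul, hp, zero_mul]

theorem pureDimPart_one_curve {A : MvPolynomial (Fin 2) ℂ} (hA : A ≠ 0) :
    pureDimPart 1 (zariskiClosure (curve A)) = curve A := by
  ext p
  rw [mem_pureDimPart_one]
  constructor
  · rintro ⟨f, hf, hp⟩
    obtain ⟨k, rfl⟩ := ((isCurveFactor_curve hA).1 hf).2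
    change MvPolynomial.aeval p (f * k) = 0
    rw [map_mul, hp, zero_mul]
  · intro hp
    obtain ⟨f, h1, h2, h3⟩ := exists_irreducible_dvd_of_aeval_eq_zero hA hp
    exact ⟨f, (isCurveFactor_curve hA).2 ⟨h1, h2⟩, h3⟩

/-- The complex polynomial with the same coefficients. -/
abbrev toComplex : MvPolynomial (Fin 2) ℤ →+* MvPolynomial (Fin 2) ℂ :=
  MvPolynomial.map (Int.castRingHom ℂ)

theorem toComplex_injective : Function.Injective toComplex :=
  MvPolynomial.map_injective _ (RingHom.injective_int _)

theorem aeval_toComplex (p : Fin 2 → ℂ) (f : MvPolynomial (Fin 2) ℤ) :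
    MvPolynomial.aeval p (toComplex f) = MvPolynomial.aeval p f := by
  rw [MvPolynomial.aeval_def, MvPolynomial.eval₂_map, MvPolynomial.aeval_def]
  congr 1

theorem zeros_eq_curve (f : MvPolynomial (Fin 2) ℤ) : zeros f = curve (toComplex f) := by
  ext p
  rw [curve, Set.mem_ofPred_eq, aeval_toComplex, zeros, Set.mem_ofPred_eq]

theorem aeval_aeval_X_int (p : Fin 2 → ℂ) (c : ℤ[X]) :
    MvPolynomial.aeval p (Polynomial.aeval (MvPolynomial.X 1 : MvPolynomial (Fin 2) ℤ) c) =
      (c.map (Int.castRingHom ℂ)).eval (p 1) := by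
  rw [← Polynomial.aeval_algHom_apply, MvPolynomial.aeval_X, Polynomial.eval_map,
    Polynomial.aeval_def]
  congr 1

theorem map_int_ne_zero {c : ℤ[X]} (hc : c ≠ 0) : c.map (Int.castRingHom ℂ) ≠ 0 :=
  (Polynomial.map_ne_zero_iff (RingHom.injective_int _)).2 hc

theorem essentiallyEqual_zeros {f g : MvPolynomial (Fin 2) ℤ} (h : EssentiallyEqualPoly f g) :
    EssentiallyEqual (zeros f) (zeros g) := by
  obtain ⟨c, d, hc, hd, h⟩ := h
  refine essentiallyEqual_of_agree (mul_ne_zero (map_int_ne_zero hc) (map_int_ne_zero hd))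
    fun p hp => ?_
  have h1 := congrArg (MvPolynomial.aeval p) h
  rw [map_mul, map_mul, aeval_aeval_X_int, aeval_aeval_X_int] at h1
  rw [Polynomial.eval_mul] at hp
  have hc0 := left_ne_zero_of_mul hp
  have hd0 := right_ne_zero_of_mul hp
  constructor
  · intro hf
    rw [show MvPolynomial.aeval p f = 0 from hf, mul_zero] at h1
    exact (mul_eq_zero.1 h1.symm).resolve_left hd0
  · intro hf
    rw [show MvPolynomial.aeval p g = 0 from hf, mul_zero] at h1
    exact (mul_eq_zero.1 h1).resolve_left hc0

theorem pureDimPart_one_zariskiClosure_eq_zeroLocus (S : Set (Fin 2 → ℂ)) :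
    MvPolynomial.zeroLocus ℂ (MvPolynomial.vanishingIdeal ℂ (pureDimPart 1 (zariskiClosure S))) =
      pureDimPart 1 (zariskiClosure S) := by
  obtain ⟨g, -, -, hV⟩ := exists_pureDimPart_one_eq S
  refine Set.Subset.antisymm (fun p hp => (hV p).2 (hp g fun x hx => (hV x).1 hx))
    (MvPolynomial.zeroLocus_vanishingIdeal_le _)

/-- Primitivity excludes `0`, which is divisible by the nonunit `2`. -/
theorem Knot.IsAPolynomial.ne_zero {K : Knot} {A : MvPolynomial (Fin 2) ℤ} (h : K.IsAPolynomial A) :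
    A ≠ 0 := by
  rintro rfl
  have := h.2 2 (dvd_zero _)
  rw [Int.isUnit_iff] at this
  omega

theorem Knot.IsAPolynomial.pureDimPart_eq {K : Knot} {A : MvPolynomial (Fin 2) ℤ}
    (h : K.IsAPolynomial A) :
    pureDimPart 1 (zariskiClosure K.deformationVariety) = zeros A := by
  rw [← pureDimPart_one_zariskiClosure_eq_zeroLocus, h.1, zeros_eq_curve]
  ext p
  exact mem_zeroLocus_span_singleton

theorem Knot.IsAPolynomial.essentiallyEqual {K : Knot} {A : MvPolynomial (Fin 2) ℤ}
    (h : K.IsAPolynomial A) : EssentiallyEqual K.deformationVariety (zeros A) := by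
  refine ⟨∅, ∅, ?_⟩
  rw [h.pureDimPart_eq, zeros_eq_curve, pureDimPart_one_curve]
  exact (map_ne_zero_iff _ toComplex_injective).2 h.ne_zero

/-! ### The double covering `(L, M) ↦ (L, M²)` -/

/-- The map `(L, M) ↦ (L, M²)`. -/
def sqMap (p : Fin 2 → ℂ) : Fin 2 → ℂ := ![p 0, p 1 ^ 2]

/-- The substitution of `M²` for the second variable. -/
def sqHom : MvPolynomial (Fin 2) ℂ →ₐ[ℂ] MvPolynomial (Fin 2) ℂ :=
  MvPolynomial.aeval ![MvPolynomial.X 0, MvPolynomial.X 1 ^ 2]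

/-- The substitution of `-M` for the second variable. -/
def negHom : MvPolynomial (Fin 2) ℂ →ₐ[ℂ] MvPolynomial (Fin 2) ℂ :=
  MvPolynomial.aeval ![MvPolynomial.X 0, -MvPolynomial.X 1]

@[simp] theorem sqHom_X_zero : sqHom (MvPolynomial.X 0) = MvPolynomial.X 0 := by simp [sqHom]

@[simp] theorem sqHom_X_one : sqHom (MvPolynomial.X 1) = MvPolynomial.X 1 ^ 2 := by simp [sqHom]

@[simp] theorem negHom_X_zero : negHom (MvPolynomial.X 0) = MvPolynomial.X 0 := by simp [negHom]

@[simp] theorem negHom_X_one : negHom (MvPolynomial.X 1) = -MvPolynomial.X 1 := by simp [negHom]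

@[simp] theorem negHom_sqHom (f : MvPolynomial (Fin 2) ℂ) : negHom (sqHom f) = sqHom f := by
  rw [← AlgHom.comp_apply]
  congr 1
  apply MvPolynomial.algHom_ext
  intro i; fin_cases i <;> simp

@[simp] theorem negHom_negHom (f : MvPolynomial (Fin 2) ℂ) : negHom (negHom f) = f := by
  rw [← AlgHom.comp_apply]
  conv_rhs => rw [← AlgHom.id_apply (R := ℂ) f]
  congr 1
  apply MvPolynomial.algHom_ext
  intro i; fin_cases i <;> simp

theorem aeval_sqHom (p : Fin 2 → ℂ) (f : MvPolynomial (Fin 2) ℂ) :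
    MvPolynomial.aeval p (sqHom f) = MvPolynomial.aeval (sqMap p) f := by
  rw [← AlgHom.comp_apply]
  congr 1
  apply MvPolynomial.algHom_ext
  intro i; fin_cases i <;> simp [sqMap]

theorem sqMap_surjective : Function.Surjective sqMap := by
  intro p
  obtain ⟨z, hz⟩ := IsAlgClosed.exists_pow_nat_eq (p 1) (n := 2) (by norm_num)
  refine ⟨![p 0, z], ?_⟩
  ext i; fin_cases i <;> simp [sqMap, hz]

theorem sqHom_injective : Function.Injective sqHom := by
  rw [injective_iff_map_eq_zero]
  intro f hf
  apply MvPolynomial.funext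
  intro p
  obtain ⟨p, rfl⟩ := sqMap_surjective p
  have := aeval_sqHom p f
  rw [hf, map_zero] at this
  simpa using this.symm

/-- This splits `k` into its even and odd parts in `M`. -/
theorem exists_eq_sqHom_add (k : MvPolynomial (Fin 2) ℂ) :
    ∃ a b, k = sqHom a + MvPolynomial.X 1 * sqHom b := by
  induction k using MvPolynomial.induction_on with
  | C c => exact ⟨MvPolynomial.C c, 0, by simp [sqHom]⟩
  | add p q hp hq =>
    obtain ⟨a, b, rfl⟩ := hp
    obtain ⟨c, d, rfl⟩ := hq
    exact ⟨a + c, b + d, by simp only [map_add]; ring⟩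
  | mul_X p i hp =>
    obtain ⟨a, b, rfl⟩ := hp
    fin_cases i
    · exact ⟨a * MvPolynomial.X 0, b * MvPolynomial.X 0, by simp; ring⟩
    · exact ⟨MvPolynomial.X 1 * b, a, by simp; ring⟩

/-- The product is the norm of `k` for the covering involution `M ↦ -M`. -/
theorem exists_mul_negHom_eq (k : MvPolynomial (Fin 2) ℂ) : ∃ n, k * negHom k = sqHom n := by
  obtain ⟨a, b, rfl⟩ := exists_eq_sqHom_add k
  exact ⟨a ^ 2 - MvPolynomial.X 1 * b ^ 2, by simp; ring⟩

theorem dvd_of_sqHom_dvd {n m : MvPolynomial (Fin 2) ℂ} (h : sqHom n ∣ sqHom m) : n ∣ m := by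
  obtain ⟨k, hk⟩ := h
  obtain ⟨a, b, rfl⟩ := exists_eq_sqHom_add k
  have h1 := congrArg negHom hk
  simp only [map_mul, map_add, negHom_sqHom, negHom_X_one] at h1
  refine ⟨a, sqHom_injective ?_⟩
  have h2 : (2 : MvPolynomial (Fin 2) ℂ) * (sqHom m - sqHom n * sqHom a) = 0 := by
    linear_combination hk + h1
  rw [map_mul]
  exact sub_eq_zero.1 ((mul_eq_zero.1 h2).resolve_left two_ne_zero)

/-- An irreducible `f'` upstairs lies over only one irreducible polynomial downstairs: if `f'`
divides `sqHom m`, its norm `n` divides `m ^ 2`. An irreducible factor of `n` thus divides both `f`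
and `h`, and it is associated to `f`. -/
theorem dvd_of_dvd_sqHom {f f' h : MvPolynomial (Fin 2) ℂ} (hf : Irreducible f)
    (hf' : Irreducible f') (h1 : f' ∣ sqHom f) (h2 : f' ∣ sqHom h) : f ∣ h := by
  obtain ⟨n, hn⟩ := exists_mul_negHom_eq f'
  have key : ∀ m, f' ∣ sqHom m → n ∣ m ^ 2 := fun m hm => by
    apply dvd_of_sqHom_dvd
    rw [← hn, map_pow, pow_two]
    refine mul_dvd_mul hm ?_
    have := map_dvd negHom hm
    rwa [negHom_sqHom] at this
  have hnu : ¬ IsUnit n := fun hu => hf'.not_isUnit <| by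
    have := hu.map sqHom
    rw [← hn] at this
    exact isUnit_of_mul_isUnit_left this
  have hn0 : n ≠ 0 := by
    rintro rfl
    rw [map_zero, mul_eq_zero] at hn
    rcases hn with hn | hn
    · exact hf'.ne_zero hn
    · have := congrArg negHom hn
      rw [negHom_negHom, map_zero] at this
      exact hf'.ne_zero this
  obtain ⟨f₀, hf₀, hd⟩ := WfDvdMonoid.exists_irreducible_factor hnu hn0
  have h3 : f₀ ∣ f := hf₀.prime.dvd_of_dvd_pow (hd.trans (key f h1))
  have h4 : f₀ ∣ h := hf₀.prime.dvd_of_dvd_pow (hd.trans (key h h2))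
  exact (hf₀.associated_of_dvd hf h3).symm.dvd.trans h4

theorem mem_vanishingIdeal_sqMap_image {S : Set (Fin 2 → ℂ)} {h : MvPolynomial (Fin 2) ℂ} :
    h ∈ MvPolynomial.vanishingIdeal ℂ (sqMap '' S) ↔
      sqHom h ∈ MvPolynomial.vanishingIdeal ℂ S := by
  simp only [MvPolynomial.mem_vanishingIdeal_iff, Set.forall_mem_image, aeval_sqHom]

theorem vanishingIdeal_sqMap_image_ne_bot {S : Set (Fin 2 → ℂ)} :
    MvPolynomial.vanishingIdeal ℂ (sqMap '' S) ≠ ⊥ ↔ MvPolynomial.vanishingIdeal ℂ S ≠ ⊥ := by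
  rw [Submodule.ne_bot_iff, Submodule.ne_bot_iff]
  constructor
  · rintro ⟨h, h1, h2⟩
    exact ⟨sqHom h, mem_vanishingIdeal_sqMap_image.1 h1,
      (map_ne_zero_iff _ sqHom_injective).2 h2⟩
  · rintro ⟨h, h1, h2⟩
    obtain ⟨n, hn⟩ := exists_mul_negHom_eq h
    refine ⟨n, mem_vanishingIdeal_sqMap_image.2 (hn ▸ Ideal.mul_mem_right _ _ h1), ?_⟩
    rintro rfl
    rw [map_zero, mul_eq_zero] at hn
    rcases hn with hn | hn
    · exact h2 hn
    · have := congrArg negHom hn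
      rw [negHom_negHom, map_zero] at this
      exact h2 this

theorem Irreducible.negHom {f : MvPolynomial (Fin 2) ℂ} (hf : Irreducible f) :
    Irreducible (negHom f) := by
  let e : MvPolynomial (Fin 2) ℂ ≃ₐ[ℂ] MvPolynomial (Fin 2) ℂ :=
    AlgEquiv.ofAlgHom AJ.negHom AJ.negHom (AlgHom.ext negHom_negHom) (AlgHom.ext negHom_negHom)
  exact (MulEquiv.irreducible_iff e).2 hf

/-- Components of the image are the images of components. For the forward direction, a factor `f₁`
of `sqHom f` divides the norm of each element of the vanishing ideal of `S`, so `f₁` or its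
conjugate divides the element itself. -/
theorem isCurveFactor_sqMap_image {S : Set (Fin 2 → ℂ)} {f : MvPolynomial (Fin 2) ℂ}
    (hf : Irreducible f) :
    IsCurveFactor (sqMap '' S) f ↔ ∃ f', f' ∣ sqHom f ∧ IsCurveFactor S f' := by
  constructor
  · rintro ⟨-, h0, hd⟩
    have hu : ¬ IsUnit (sqHom f) := fun hu => hf.not_isUnit <| by
      rw [isUnit_iff_dvd_one, ← map_one sqHom] at hu
      exact isUnit_of_dvd_one (dvd_of_sqHom_dvd hu)
    obtain ⟨f₁, hf₁, hd₁⟩ := WfDvdMonoid.exists_irreducible_factor hu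
      ((map_ne_zero_iff _ sqHom_injective).2 hf.ne_zero)
    have hd₂ : AJ.negHom f₁ ∣ sqHom f := by simpa using map_dvd AJ.negHom hd₁
    have hf₂ : Irreducible (AJ.negHom f₁) := Irreducible.negHom hf₁
    have hsub : (MvPolynomial.vanishingIdeal ℂ S : Set (MvPolynomial (Fin 2) ℂ)) ⊆
        (Ideal.span {f₁} : Ideal _) ∪ (Ideal.span {AJ.negHom f₁} : Ideal _) := by
      intro h hh
      obtain ⟨n, hn⟩ := exists_mul_negHom_eq h
      have h1 := hd n (mem_vanishingIdeal_sqMap_image.2 (hn ▸ Ideal.mul_mem_right _ _ hh))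
      have h2 : f₁ ∣ h * AJ.negHom h := hn ▸ hd₁.trans (map_dvd sqHom h1)
      rcases hf₁.prime.dvd_or_dvd h2 with h3 | h3
      · exact Or.inl (Ideal.mem_span_singleton.2 h3)
      · exact Or.inr (Ideal.mem_span_singleton.2 (by simpa using map_dvd AJ.negHom h3))
    have h0' := vanishingIdeal_sqMap_image_ne_bot.1 h0
    -- An ideal contained in the union of two ideals lies in one of them, so the choice between `f₁`
    -- and its conjugate is uniform.
    rcases Ideal.subset_union.1 hsub with h | h
    · exact ⟨f₁, hd₁, hf₁, h0', fun k hk => Ideal.mem_span_singleton.1 (h hk)⟩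
    · exact ⟨_, hd₂, hf₂, h0', fun k hk => Ideal.mem_span_singleton.1 (h hk)⟩
  · rintro ⟨f', h1, hf', h0, hd⟩
    exact ⟨hf, vanishingIdeal_sqMap_image_ne_bot.2 h0, fun h hh =>
      dvd_of_dvd_sqHom hf hf' h1 (hd _ (mem_vanishingIdeal_sqMap_image.1 hh))⟩

theorem irreducible_X (i : Fin 2) : Irreducible (MvPolynomial.X i : MvPolynomial (Fin 2) ℂ) := by
  simpa using irreducible_X_sub_C i 0

/-- Powers of `X 0` have no zeros on the torus and can be stripped from any element of the vanishing
ideal. -/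
theorem IsCurveFactor.not_dvd_X_zero {S : Set (Fin 2 → ℂ)} (hS : S ⊆ torus)
    {f : MvPolynomial (Fin 2) ℂ} (hf : IsCurveFactor S f) : ¬ f ∣ MvPolynomial.X 0 := by
  intro hd
  have ha := hf.1.associated_of_dvd (irreducible_X 0) hd
  obtain ⟨h, hh, hh0⟩ := (Submodule.ne_bot_iff _).1 hf.2.1
  obtain ⟨n, k, hk, rfl⟩ := WfDvdMonoid.max_power_factor hh0 (irreducible_X 0)
  refine hk (ha.symm.dvd.trans (hf.2.2 k fun p hp => ?_))
  have := hh p hp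
  rw [map_mul, map_pow, MvPolynomial.aeval_X, mul_eq_zero] at this
  exact this.resolve_left (pow_ne_zero _ (hS hp).1)

/-- The line `M = a` maps into the line `Q = a ^ 2`. -/
theorem isHorizontal_of_dvd_sqHom {f f' : MvPolynomial (Fin 2) ℂ} (hf : Irreducible f)
    (hf' : IsHorizontal f') (hd : f' ∣ sqHom f) : IsHorizontal f := by
  obtain ⟨a, ha⟩ := hf'
  have h2 : MvPolynomial.X 1 - MvPolynomial.C a ∣
      sqHom (MvPolynomial.X 1 - MvPolynomial.C (a ^ 2)) := by
    refine ⟨MvPolynomial.X 1 + MvPolynomial.C a, ?_⟩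
    rw [map_sub, sqHom_X_one, MvPolynomial.algHom_C, MvPolynomial.algebraMap_eq, map_pow]
    ring
  exact ⟨a ^ 2, hf.associated_of_dvd (irreducible_X_sub_C 1 _)
    (dvd_of_dvd_sqHom hf (irreducible_X_sub_C 1 a) (ha.symm.dvd.trans hd) h2)⟩

theorem essentiallyEqual_sqMap_image {S : Set (Fin 2 → ℂ)} (hS : S ⊆ torus)
    {g : MvPolynomial (Fin 2) ℂ} (hg : g ≠ 0) (h : EssentiallyEqual S (curve (sqHom g))) :
    EssentiallyEqual (curve g ∩ torus) (sqMap '' S) := by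
  have hS' : sqMap '' S ⊆ torus := by
    rintro _ ⟨p, hp, rfl⟩
    exact ⟨(hS hp).1, pow_ne_zero 2 (hS hp).2⟩
  refine essentiallyEqual_of_isCurveFactor_iff fun f hf hl => ?_
  -- The line `x = 0` is not horizontal, but neither set can have it as a component since both lie
  -- in the torus.
  by_cases hX : f ∣ MvPolynomial.X 0
  · exact ⟨fun h1 => absurd hX (h1.not_dvd_X_zero Set.inter_subset_right),
      fun h1 => absurd hX (h1.not_dvd_X_zero hS')⟩
  have hX1 : ¬ f ∣ MvPolynomial.X 1 := fun hd =>
    hl ⟨0, by simpa using hf.associated_of_dvd (irreducible_X 1) hd⟩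
  have hu : ¬ f ∣ MvPolynomial.X 0 * MvPolynomial.X 1 := fun hd =>
    (hf.prime.dvd_or_dvd hd).elim hX hX1
  have h1 : IsCurveFactor (curve g ∩ torus) f ↔ IsCurveFactor (curve g) f := by
    refine isCurveFactor_iff_of_agree
      (mul_ne_zero (irreducible_X 0).ne_zero (irreducible_X 1).ne_zero) (fun p hp => ?_) hu
    rw [map_mul, MvPolynomial.aeval_X, MvPolynomial.aeval_X] at hp
    exact ⟨fun h => h.1, fun h => ⟨h, left_ne_zero_of_mul hp, right_ne_zero_of_mul hp⟩⟩
  have hg' : sqHom g ≠ 0 := (map_ne_zero_iff _ sqHom_injective).2 hg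
  rw [h1, isCurveFactor_curve hg, isCurveFactor_sqMap_image hf]
  constructor
  · rintro ⟨-, hd⟩
    have hfu : ¬ IsUnit (sqHom f) := fun hu => hf.not_isUnit <| by
      rw [isUnit_iff_dvd_one, ← map_one sqHom] at hu
      exact isUnit_of_dvd_one (dvd_of_sqHom_dvd hu)
    obtain ⟨f', hf', hd'⟩ := WfDvdMonoid.exists_irreducible_factor hfu
      ((map_ne_zero_iff _ sqHom_injective).2 hf.ne_zero)
    refine ⟨f', hd', (h.isCurveFactor_iff fun hl' => hl (isHorizontal_of_dvd_sqHom hf hl' hd')).2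
      ((isCurveFactor_curve hg').2 ⟨hf', hd'.trans (map_dvd sqHom hd)⟩)⟩
  · rintro ⟨f', hd', hc⟩
    have hl' : ¬ IsHorizontal f' := fun hl' => hl (isHorizontal_of_dvd_sqHom hf hl' hd')
    exact ⟨hf, dvd_of_dvd_sqHom hf hc.1 hd'
      ((isCurveFactor_curve hg').1 ((h.isCurveFactor_iff hl').1 hc)).2⟩

theorem Knot.deformationVariety_subset_torus (K : Knot) : K.deformationVariety ⊆ torus := by
  rintro p ⟨ρ, h1, h2, h3, h4⟩
  have key : ∀ M : Matrix.SpecialLinearGroup (Fin 2) ℂ, M 1 0 = 0 → M 0 0 ≠ 0 := by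
    intro M h h0
    have := M.det_coe
    rw [Matrix.det_fin_two, h, h0] at this
    simp at this
  exact ⟨h3 ▸ key _ h1, h4 ▸ key _ h2⟩

theorem toComplex_substSq (f : MvPolynomial (Fin 2) ℤ) :
    toComplex (substSq f) = sqHom (toComplex f) := by
  have : toComplex.comp (MvPolynomial.aeval (R := ℤ)
      ![MvPolynomial.X 0, (MvPolynomial.X 1 : MvPolynomial (Fin 2) ℤ) ^ 2]).toRingHom =
      sqHom.toRingHom.comp toComplex := by
    apply MvPolynomial.ringHom_ext
    · intro r; simp
    · intro i; fin_cases i <;> simp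
  exact congrArg (fun φ => φ f) this

theorem essentiallyEqual_deformationVarietySq {K : Knot} {A g : MvPolynomial (Fin 2) ℤ}
    (hA : K.IsAPolynomial A) (h : EssentiallyEqualPoly A (substSq g)) :
    EssentiallyEqual (zeros g ∩ torus) K.deformationVarietySq := by
  have h1 := hA.essentiallyEqual.trans (essentiallyEqual_zeros h)
  rw [zeros_eq_curve, toComplex_substSq] at h1
  -- Since `A ≠ 0`, the hypothesis itself rules out `g = 0`, where the zero set would be the whole
  -- plane.
  have hg : g ≠ 0 := by
    rintro rfl
    obtain ⟨c, d, hc, -, h⟩ := h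
    rw [substSq, map_zero, mul_zero, mul_eq_zero] at h
    refine h.elim (fun h0 => hc ?_) hA.ne_zero
    exact (transcendental_iff.1 (MvPolynomial.transcendental_X (R := ℤ) (1 : Fin 2))) c h0
  rw [zeros_eq_curve]
  exact essentiallyEqual_sqMap_image K.deformationVariety_subset_torus
    ((map_ne_zero_iff _ toComplex_injective).2 hg) h1

/-! ### The fixed field of the automorphisms of `ℂ` -/

/-- The algebra generated by `v` is a polynomial ring, on which `σ₀` and the permutation `e` of the
variables define an automorphism; `ℂ` is an algebraic closure of it. -/
theorem exists_ringEquiv_extending {K : Type*} [Field K] [Algebra K ℂ] (σ₀ : K ≃+* K) {ι : Type*}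
    {v : ι → ℂ} (hv : IsTranscendenceBasis K v) (e : ι ≃ ι) :
    ∃ σ : ℂ ≃+* ℂ, (∀ k : K, σ (algebraMap K ℂ k) = algebraMap K ℂ (σ₀ k)) ∧
      ∀ i, σ (v i) = v (e i) := by
  have hcl := IsAlgClosed.isAlgClosure_of_transcendence_basis v hv
  let e' : Algebra.adjoin K (Set.range v) ≃+* Algebra.adjoin K (Set.range v) :=
    hv.1.aevalEquiv.symm.toRingEquiv.trans ((MvPolynomial.mapEquiv ι σ₀).trans
      ((MvPolynomial.renameEquiv K e).toRingEquiv.trans hv.1.aevalEquiv.toRingEquiv))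
  have key : ∀ p : MvPolynomial ι K, IsAlgClosure.equivOfEquiv ℂ ℂ e' (MvPolynomial.aeval v p) =
      MvPolynomial.aeval v (MvPolynomial.rename e (MvPolynomial.map (σ₀ : K →+* K) p)) := by
    intro p
    rw [← hv.1.algebraMap_aevalEquiv, ← hv.1.algebraMap_aevalEquiv,
      IsAlgClosure.equivOfEquiv_algebraMap]
    simp [e']
  refine ⟨IsAlgClosure.equivOfEquiv ℂ ℂ e', fun k => ?_, fun i => ?_⟩
  · simpa using key (MvPolynomial.C k)
  · simpa using key (MvPolynomial.X i)

theorem exists_ringEquiv_algebraicClosure_ne {F E : Type*} [Field F] [CharZero F] [Field E]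
    [IsAlgClosed E] [Algebra F E] (x : algebraicClosure F E)
    (hq : ∀ r : F, algebraMap F E r ≠ x) :
    ∃ σ : algebraicClosure F E ≃+* algebraicClosure F E, σ x ≠ x := by
  have hn : Normal F (algebraicClosure F E) := IsAlgClosure.normal _ _
  have : IsGalois F (algebraicClosure F E) := ⟨⟩
  have h1 : x ∉ (⊥ : IntermediateField F (algebraicClosure F E)) := by
    rintro ⟨r, hr⟩
    exact hq r (congrArg Subtype.val hr)
  rw [InfiniteGalois.mem_bot_iff_fixed] at h1
  push Not at h1
  obtain ⟨σ, hσ⟩ := h1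
  exact ⟨σ.toRingEquiv, hσ⟩

theorem exists_ringEquiv_ne_of_isAlgebraic {x : ℂ} (hx : x ∈ algebraicClosure ℚ ℂ)
    (hq : ∀ r : ℚ, (r : ℂ) ≠ x) : ∃ σ : ℂ ≃+* ℂ, σ x ≠ x := by
  obtain ⟨σ₀, hσ⟩ := exists_ringEquiv_algebraicClosure_ne (⟨x, hx⟩ : algebraicClosure ℚ ℂ)
    fun r => by simpa using hq r
  obtain ⟨s, hs⟩ := exists_isTranscendenceBasis (algebraicClosure ℚ ℂ) ℂ
  obtain ⟨σ, hσ', -⟩ := exists_ringEquiv_extending σ₀ hs (Equiv.refl _)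
  refine ⟨σ, fun h => hσ (Subtype.ext ?_)⟩
  exact (hσ' ⟨x, hx⟩).symm.trans h

/-- Extend `x` to a transcendence basis and swap it with another basis element, which exists because
`ℂ` is uncountable. -/
theorem exists_ringEquiv_ne_of_transcendental {x : ℂ} (hx : Transcendental ℚ x) :
    ∃ σ : ℂ ≃+* ℂ, σ x ≠ x := by
  have h1 : AlgebraicIndepOn ℚ id {x} :=
    algebraicIndependent_unique_type_iff.2 hx
  obtain ⟨t, ht, hb⟩ := exists_isTranscendenceBasis_superset h1
  have hc : Cardinal.mk ℂ = Cardinal.mk t :=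
    IsAlgClosed.cardinal_eq_cardinal_transcendence_basis_of_aleph0_lt' _ hb (by simp)
      (by rw [Cardinal.mk_complex]; exact Cardinal.aleph0_lt_continuum)
  have hnt : Nontrivial t := by
    rw [← Cardinal.one_lt_iff_nontrivial, ← hc, Cardinal.mk_complex]
    exact Cardinal.one_lt_aleph0.trans Cardinal.aleph0_lt_continuum
  obtain ⟨y, hy⟩ := exists_ne (⟨x, ht rfl⟩ : t)
  classical
  obtain ⟨σ, -, hσ⟩ := exists_ringEquiv_extending (RingEquiv.refl ℚ) hb
    (Equiv.swap (⟨x, ht rfl⟩ : t) y)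
  refine ⟨σ, fun h => hy (Subtype.ext ?_)⟩
  have := hσ ⟨x, ht rfl⟩
  rw [Equiv.swap_apply_left] at this
  exact this.symm.trans h

theorem exists_rat_of_fixed {x : ℂ} (hx : ∀ σ : ℂ ≃+* ℂ, σ x = x) : ∃ r : ℚ, (r : ℂ) = x := by
  by_contra! hq
  by_cases h : IsAlgebraic ℚ x
  · obtain ⟨σ, hσ⟩ :=
      exists_ringEquiv_ne_of_isAlgebraic ((mem_algebraicClosure_iff).2 h) hq
    exact hσ (hx σ)
  · obtain ⟨σ, hσ⟩ := exists_ringEquiv_ne_of_transcendental h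
    exact hσ (hx σ)

/-! ### Existence of an A-polynomial by descent to integral coefficients -/

theorem aeval_map_ringEquiv (σ : ℂ ≃+* ℂ) (h : MvPolynomial (Fin 2) ℂ) (p : Fin 2 → ℂ) :
    MvPolynomial.aeval (σ ∘ p) (MvPolynomial.map (σ : ℂ →+* ℂ) h) =
      σ (MvPolynomial.aeval p h) := by
  induction h using MvPolynomial.induction_on with
  | C a => simp
  | add p q hp hq => rw [map_add, map_add, hp, hq, map_add, map_add]
  | mul_X p i hp => rw [map_mul, map_mul, hp]; simp

/-- Invariance under the automorphisms of the complex numbers. -/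
def IsConjugationInvariant (S : Set (Fin 2 → ℂ)) : Prop :=
  ∀ σ : ℂ ≃+* ℂ, ∀ p ∈ S, σ ∘ p ∈ S

theorem map_symm_map (σ : ℂ ≃+* ℂ) (f : MvPolynomial (Fin 2) ℂ) :
    MvPolynomial.map (σ : ℂ →+* ℂ) (MvPolynomial.map (σ.symm : ℂ →+* ℂ) f) = f := by
  rw [MvPolynomial.map_map]
  convert! MvPolynomial.map_id f
  ext x; simp

theorem map_dvd_iff (σ : ℂ ≃+* ℂ) {f h : MvPolynomial (Fin 2) ℂ} :
    MvPolynomial.map (σ : ℂ →+* ℂ) f ∣ h ↔ f ∣ MvPolynomial.map (σ.symm : ℂ →+* ℂ) h := by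
  constructor
  · intro hd
    have := map_dvd (MvPolynomial.map (σ.symm : ℂ →+* ℂ)) hd
    rwa [show MvPolynomial.map (σ.symm : ℂ →+* ℂ) (MvPolynomial.map (σ : ℂ →+* ℂ) f) = f from
      map_symm_map σ.symm f] at this
  · intro hd
    have := map_dvd (MvPolynomial.map (σ : ℂ →+* ℂ)) hd
    rwa [map_symm_map] at this

theorem IsConjugationInvariant.map_mem {S : Set (Fin 2 → ℂ)} (hS : IsConjugationInvariant S)
    (σ : ℂ ≃+* ℂ) {h : MvPolynomial (Fin 2) ℂ} (hh : h ∈ MvPolynomial.vanishingIdeal ℂ S) :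
    MvPolynomial.map (σ : ℂ →+* ℂ) h ∈ MvPolynomial.vanishingIdeal ℂ S := by
  intro p hp
  have h1 := aeval_map_ringEquiv σ h (σ.symm ∘ p)
  rw [hh _ (hS σ.symm p hp), map_zero] at h1
  convert h1 using 2
  congr 1
  ext i; simp

theorem IsConjugationInvariant.isCurveFactor {S : Set (Fin 2 → ℂ)}
    (hS : IsConjugationInvariant S) (σ : ℂ ≃+* ℂ) {f : MvPolynomial (Fin 2) ℂ}
    (hf : IsCurveFactor S f) : IsCurveFactor S (MvPolynomial.map (σ : ℂ →+* ℂ) f) :=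
  ⟨(MulEquiv.irreducible_iff (MvPolynomial.mapEquiv (Fin 2) σ)).2 hf.1, hf.2.1,
    fun _ hh => (map_dvd_iff σ).2 (hf.2.2 _ (hS.map_mem σ.symm hh))⟩

theorem IsConjugationInvariant.pureDimPart_one {S : Set (Fin 2 → ℂ)}
    (hS : IsConjugationInvariant S) :
    IsConjugationInvariant (pureDimPart 1 (zariskiClosure S)) := by
  intro σ p hp
  obtain ⟨f, hf, hfp⟩ := mem_pureDimPart_one.1 hp
  exact mem_pureDimPart_one.2 ⟨_, hS.isCurveFactor σ hf, by rw [aeval_map_ringEquiv, hfp, map_zero]⟩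

/-- By the Nullstellensatz the generator is the squarefree part of an equation `g` of the
one-dimensional part. -/
theorem exists_vanishingIdeal_pureDimPart_one (S : Set (Fin 2 → ℂ)) :
    ∃ r : MvPolynomial (Fin 2) ℂ, r ≠ 0 ∧
      MvPolynomial.vanishingIdeal ℂ (pureDimPart 1 (zariskiClosure S)) = Ideal.span {r} := by
  obtain ⟨g, hg, -, hV⟩ := exists_pureDimPart_one_eq S
  let := UniqueFactorizationMonoid.strongNormalizationMonoid (α := MvPolynomial (Fin 2) ℂ)
  refine ⟨UniqueFactorizationMonoid.radical g, UniqueFactorizationMonoid.radical_ne_zero, ?_⟩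
  have : pureDimPart 1 (zariskiClosure S) = MvPolynomial.zeroLocus ℂ (Ideal.span {g}) := by
    ext p
    rw [hV, mem_zeroLocus_span_singleton]
  rw [this, MvPolynomial.vanishingIdeal_zeroLocus_eq_radical]
  ext h
  rw [Ideal.mem_span_singleton, ← UniqueFactorizationMonoid.exists_dvd_pow_iff_radical_dvd hg,
    Ideal.mem_radical_iff]
  simp only [Ideal.mem_span_singleton]

/-- Each conjugate of `r` is a constant multiple of `r`. Once one coefficient is scaled to `1`, the
constant is `1`, so all coefficients are fixed by every automorphism and hence rational. -/
theorem exists_rational_generator {r : MvPolynomial (Fin 2) ℂ} (hr : r ≠ 0)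
    (h : ∀ σ : ℂ ≃+* ℂ, r ∣ MvPolynomial.map (σ : ℂ →+* ℂ) r) :
    ∃ B : MvPolynomial (Fin 2) ℚ, B ≠ 0 ∧
      Associated r (MvPolynomial.map (algebraMap ℚ ℂ) B) := by
  obtain ⟨m, hm⟩ := MvPolynomial.ne_zero_iff.1 hr
  set a := MvPolynomial.coeff m r with ha
  have hfix : ∀ σ : ℂ ≃+* ℂ, MvPolynomial.map (σ : ℂ →+* ℂ) (MvPolynomial.C a⁻¹ * r) =
      MvPolynomial.C a⁻¹ * r := by
    intro σ
    have h1 : Associated r (MvPolynomial.map (σ : ℂ →+* ℂ) r) :=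
      associated_of_dvd_dvd (h σ) ((map_dvd_iff σ).2 (h σ.symm))
    obtain ⟨u, hu⟩ := h1
    obtain ⟨c, -, hc⟩ := MvPolynomial.isUnit_iff_eq_C_of_isReduced.1 u.isUnit
    rw [hc] at hu
    have h2 := congrArg (MvPolynomial.coeff m) hu
    rw [mul_comm, MvPolynomial.coeff_C_mul, MvPolynomial.coeff_map, ← ha] at h2
    have h3 : σ a ≠ 0 := by simpa using hm
    rw [map_mul, ← hu, MvPolynomial.map_C, mul_comm r, ← mul_assoc, ← map_mul]
    congr 2
    rw [RingHom.coe_coe] at h2 ⊢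
    rw [map_inv₀, ← h2]
    have hc0 : c ≠ 0 := fun h0 => h3 (by rw [← h2, h0, zero_mul])
    field_simp
  have hcoef : ∀ i, ∃ q : ℚ, (q : ℂ) = MvPolynomial.coeff i (MvPolynomial.C a⁻¹ * r) := fun i =>
    exists_rat_of_fixed fun σ => by
      conv_rhs => rw [← hfix σ]
      rw [MvPolynomial.coeff_map, RingHom.coe_coe]
  obtain ⟨B, hB⟩ : MvPolynomial.C a⁻¹ * r ∈
      Set.range (MvPolynomial.map (algebraMap ℚ ℂ) : MvPolynomial (Fin 2) ℚ →+* _) := by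
    rw [MvPolynomial.mem_range_map_iff_coeffs_subset]
    intro c hc
    obtain ⟨i, -, rfl⟩ := MvPolynomial.mem_coeffs_iff.1 hc
    obtain ⟨q, hq⟩ := hcoef i
    exact ⟨q, by simpa using hq⟩
  have hau : IsUnit (MvPolynomial.C a⁻¹ : MvPolynomial (Fin 2) ℂ) :=
    (IsUnit.mk0 _ (inv_ne_zero hm)).map MvPolynomial.C
  refine ⟨B, ?_, ?_⟩
  · rintro rfl
    rw [map_zero] at hB
    exact mul_ne_zero hau.ne_zero hr hB.symm
  · rw [hB]
    exact (associated_unit_mul_left r _ hau).symm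

theorem exists_primitive_integral {B : MvPolynomial (Fin 2) ℚ} (hB : B ≠ 0) :
    ∃ (A : MvPolynomial (Fin 2) ℤ) (c : ℚ), c ≠ 0 ∧
      MvPolynomial.map (algebraMap ℤ ℚ) A = MvPolynomial.C c * B ∧
      ∀ c : ℤ, MvPolynomial.C c ∣ A → IsUnit c := by
  obtain ⟨b, hb⟩ := IsLocalization.exist_integer_multiples (nonZeroDivisors ℤ) B.support
    fun i => MvPolynomial.coeff i B
  choose! f hf using hb
  have hs : B.support.Nonempty := MvPolynomial.support_nonempty.2 hB
  obtain ⟨g, hg, hg1⟩ := Finset.extract_gcd f hs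
  have hb0 : (b : ℤ) ≠ 0 := nonZeroDivisors.coe_ne_zero b
  set d := B.support.gcd f
  have hfg : ∀ i ∈ B.support, (d : ℚ) * g i = b * MvPolynomial.coeff i B := by
    intro i hi
    have := hf i hi
    rw [hg i hi] at this
    simpa [Submonoid.smul_def] using this
  have hd0 : (d : ℚ) ≠ 0 := by
    intro h0
    obtain ⟨i, hi⟩ := hs
    have := hfg i hi
    rw [h0, zero_mul] at this
    exact mul_ne_zero (Int.cast_ne_zero.2 hb0) (MvPolynomial.mem_support_iff.1 hi) this.symm
  have hcoeff : ∀ i, MvPolynomial.coeff i (∑ j ∈ B.support, MvPolynomial.monomial j (g j)) =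
      if i ∈ B.support then g i else 0 := by
    intro i
    classical
    rw [MvPolynomial.coeff_sum]
    simp [MvPolynomial.coeff_monomial]
  refine ⟨∑ j ∈ B.support, MvPolynomial.monomial j (g j), b / d,
    div_ne_zero (Int.cast_ne_zero.2 hb0) hd0, ?_, fun c hc => ?_⟩
  · ext i
    rw [MvPolynomial.coeff_map, hcoeff, MvPolynomial.coeff_C_mul]
    split_ifs with hi
    · rw [div_mul_eq_mul_div, ← hfg i hi, mul_div_cancel_left₀ _ hd0]
      simp
    · rw [MvPolynomial.notMem_support_iff.1 hi]
      simp
  · apply isUnit_of_dvd_one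
    rw [← hg1]
    refine Finset.dvd_gcd fun i hi => ?_
    have := (MvPolynomial.C_dvd_iff_dvd_coeff _ _).1 hc i
    rwa [hcoeff, if_pos hi] at this

theorem Knot.isConjugationInvariant_deformationVariety (K : Knot) :
    IsConjugationInvariant K.deformationVariety := by
  rintro σ p ⟨ρ, h1, h2, h3, h4⟩
  refine ⟨(Matrix.SpecialLinearGroup.map (σ : ℂ →+* ℂ)).comp ρ, ?_, ?_, ?_, ?_⟩ <;>
    simp [h1, h2, h3, h4]

theorem Knot.exists_isAPolynomial (K : Knot) : ∃ A, K.IsAPolynomial A := by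
  obtain ⟨r, hr, hI⟩ := exists_vanishingIdeal_pureDimPart_one K.deformationVariety
  have hinv : ∀ σ : ℂ ≃+* ℂ, r ∣ MvPolynomial.map (σ : ℂ →+* ℂ) r := fun σ => by
    rw [← Ideal.mem_span_singleton, ← hI]
    refine K.isConjugationInvariant_deformationVariety.pureDimPart_one.map_mem σ ?_
    rw [hI]
    exact Ideal.mem_span_singleton_self r
  obtain ⟨B, hB, ha⟩ := exists_rational_generator hr hinv
  obtain ⟨A, c, hc, hA, hprim⟩ := exists_primitive_integral hB
  refine ⟨A, ?_, hprim⟩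
  rw [hI, Ideal.span_singleton_eq_span_singleton]
  have h1 : MvPolynomial.map (Int.castRingHom ℂ) A =
      MvPolynomial.C (c : ℂ) * MvPolynomial.map (algebraMap ℚ ℂ) B := by
    have := congrArg (MvPolynomial.map (algebraMap ℚ ℂ)) hA
    rw [MvPolynomial.map_map, map_mul, MvPolynomial.map_C] at this
    rw [← eq_ratCast (algebraMap ℚ ℂ) c, ← this]
    congr 1
  rw [h1]
  exact ha.trans (associated_unit_mul_left _ _
    ((IsUnit.mk0 _ (Rat.cast_ne_zero.2 hc)).map MvPolynomial.C)).symm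

/-! ### Evaluation at `q = 1` -/

/-- Evaluation at `q = 1` of Laurent polynomials. -/
def evalOne : Zq →+* MvPolynomial (Fin 2) ℤ := LaurentPolynomial.eval₂ MvPolynomial.C 1

/-- Evaluation at `q = 1` of the coefficients of the q-Weyl algebra. -/
def epsilonCoeff : Zq[X] →+* MvPolynomial (Fin 2) ℤ :=
  Polynomial.eval₂RingHom evalOne (MvPolynomial.X 1)

theorem smul_Zq (k : Multiplicative ℕ) (a : Zq[X]) : k • a = (shiftZ ^ k.toAdd) a := rfl

theorem smul_QqQ (k : Multiplicative ℕ) (a : QqQ) : k • a = (sigma ^ k.toAdd) a := rfl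

theorem evalOne_qpow (m : ℤ) : evalOne (qpow m) = 1 := by
  simp [evalOne, LaurentPolynomial.eval₂_T]

/-- At `q = 1` the shift becomes the identity; this is what makes `ε` multiplicative. -/
theorem epsilonCoeff_shiftZ (a : Zq[X]) : epsilonCoeff (shiftZ a) = epsilonCoeff a := by
  have : epsilonCoeff.comp shiftZ = epsilonCoeff := by
    apply Polynomial.ringHom_ext
    · intro r; simp [shiftZ]
    · simp [shiftZ, epsilonCoeff, evalOne_qpow]
  exact congrArg (fun φ => φ a) this

theorem epsilonCoeff_smul (k : Multiplicative ℕ) (a : Zq[X]) :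
    epsilonCoeff (k • a) = epsilonCoeff a := by
  rw [smul_Zq]
  induction k.toAdd with
  | zero => simp
  | succ n ih => rw [pow_succ', RingHom.mul_def, RingHom.comp_apply, epsilonCoeff_shiftZ, ih]

/-- Evaluation at `q = 1`, as a ring homomorphism. -/
def epsilonHom : WeylAlgebra →+* MvPolynomial (Fin 2) ℤ :=
  SkewMonoidAlgebra.liftNCRingHom epsilonCoeff (powersHom _ (MvPolynomial.X 0)) fun {x y} => by
    rw [epsilonCoeff_smul, mul_comm]

theorem epsilonHom_apply (P : WeylAlgebra) : epsilonHom P = P.epsilon := rfl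

theorem epsilon_eq_sum (P : WeylAlgebra) :
    P.epsilon = ∑ k ∈ SkewPolynomial.support P,
      epsilonCoeff (SkewPolynomial.coeff P k) * MvPolynomial.X 0 ^ k :=
  SkewPolynomial.sum_def _ _

theorem epsilonHom_C (a : Zq[X]) : epsilonHom (SkewPolynomial.C a) = epsilonCoeff a := by
  change SkewMonoidAlgebra.liftNC _ _ (SkewMonoidAlgebra.single 1 a) = _
  simp

/-! ### The embedding in the Ore algebra -/

/-- The embedding of the coefficients of the q-Weyl algebra in `ℚ(q, Q)`. -/
def coeffToOre : Zq[X] →+* QqQ := Polynomial.eval₂RingHom (RatFunc.C.comp toQq) RatFunc.X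

theorem sigma_algebraMap (p : Qq[X]) :
    sigma (algebraMap Qq[X] QqQ p) = algebraMap Qq[X] QqQ (shiftPoly p) := by
  have h := RatFunc.map_apply_div (φ := shiftPoly)
    (nonZeroDivisors_le_comap_nonZeroDivisors_of_injective _ shiftPoly_injective) p 1
  rw [map_one, div_one, map_one, map_one, div_one] at h
  exact h

theorem sigma_C (c : Qq) : sigma (RatFunc.C c) = RatFunc.C c := by
  rw [← RatFunc.algebraMap_C, sigma_algebraMap]
  simp [shiftPoly]

theorem sigma_X : sigma RatFunc.X = RatFunc.C (RatFunc.X : Qq) * (RatFunc.X : QqQ) := by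
  rw [← RatFunc.algebraMap_X, sigma_algebraMap]
  simp [shiftPoly]

theorem toQq_qpow (m : ℤ) : toQq (qpow m) = RatFunc.X ^ m := by
  rw [toQq, LaurentPolynomial.eval₂_T]
  simp

theorem sigma_coeffToOre (a : Zq[X]) : sigma (coeffToOre a) = coeffToOre (shiftZ a) := by
  have : sigma.comp coeffToOre = coeffToOre.comp shiftZ := by
    apply Polynomial.ringHom_ext
    · intro r; simp [coeffToOre, shiftZ, sigma_C]
    · simp [coeffToOre, shiftZ, sigma_X, toQq_qpow]
  exact congrArg (fun φ => φ a) this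

theorem smul_coeffToOre (k : Multiplicative ℕ) (a : Zq[X]) :
    coeffToOre (k • a) = k • coeffToOre a := by
  rw [smul_Zq, smul_QqQ]
  induction k.toAdd with
  | zero => simp
  | succ n ih =>
    rw [pow_succ', RingHom.mul_def, RingHom.comp_apply, ← sigma_coeffToOre, ih, pow_succ' sigma]
    rfl

theorem toOre_sum_apply (P : WeylAlgebra) : P.toOre =
    SkewMonoidAlgebra.sum P fun k a => SkewMonoidAlgebra.single k (coeffToOre a) := rfl

/-- The embedding of the q-Weyl algebra in the Ore algebra, as a ring homomorphism. -/
def toOreHom : WeylAlgebra →+* OreAlgebra :=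
  SkewMonoidAlgebra.liftNCRingHom (SkewPolynomial.CRingHom.comp coeffToOre)
    (SkewMonoidAlgebra.of QqQ (Multiplicative ℕ)) fun {x y} => by
      change SkewMonoidAlgebra.single 1 (coeffToOre (y • x)) * SkewMonoidAlgebra.single y 1 =
        SkewMonoidAlgebra.single y 1 * SkewMonoidAlgebra.single 1 (coeffToOre x)
      rw [SkewMonoidAlgebra.single_mul_single, SkewMonoidAlgebra.single_mul_single,
        smul_coeffToOre]
      simp

theorem toOreHom_single (k : Multiplicative ℕ) (a : Zq[X]) :
    toOreHom (SkewMonoidAlgebra.single k a) = SkewMonoidAlgebra.single k (coeffToOre a) := by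
  change SkewMonoidAlgebra.liftNC _ _ (SkewMonoidAlgebra.single k a) = _
  rw [SkewMonoidAlgebra.liftNC_single]
  change SkewMonoidAlgebra.single 1 (coeffToOre a) * SkewMonoidAlgebra.single k 1 = _
  rw [SkewMonoidAlgebra.single_mul_single]
  simp

theorem toOreHom_apply (P : WeylAlgebra) : toOreHom P = P.toOre := by
  conv_lhs => rw [← SkewMonoidAlgebra.sum_single P]
  rw [SkewMonoidAlgebra.map_sum, toOre_sum_apply]
  simp only [toOreHom_single]

theorem coeff_toOreHom (P : WeylAlgebra) (k : ℕ) :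
    SkewPolynomial.coeff (toOreHom P) k = coeffToOre (SkewPolynomial.coeff P k) := by
  induction P using SkewMonoidAlgebra.induction_on with
  | zero => simp
  | single a b =>
    rw [toOreHom_single]
    simp only [SkewPolynomial.coeff, SkewMonoidAlgebra.coeff_single, Finsupp.single_apply]
    split_ifs <;> simp
  | add f g hf hg =>
    have h : ∀ {R : Type} [Semiring R] (p q : SkewPolynomial R), SkewPolynomial.coeff (p + q) k =
      SkewPolynomial.coeff p k + SkewPolynomial.coeff q k := fun p q => by
      simp [SkewPolynomial.coeff]
    rw [map_add, h, h, hf, hg, map_add]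

theorem toQq_toLaurent (p : ℤ[X]) :
    toQq (Polynomial.toLaurent p) = algebraMap ℚ[X] Qq (p.map (Int.castRingHom ℚ)) := by
  have : toQq.comp (Polynomial.toLaurent : ℤ[X] →+* Zq) =
      (algebraMap ℚ[X] Qq).comp (Polynomial.mapRingHom (Int.castRingHom ℚ)) := by
    apply Polynomial.ringHom_ext'
    · exact RingHom.ext_int _ _
    · simpa using toQq_qpow 1
  exact congrArg (fun φ => φ p) this

theorem toQq_injective : Function.Injective toQq := by
  rw [injective_iff_map_eq_zero]
  intro f hf
  obtain ⟨n, p, hp⟩ := LaurentPolynomial.exists_T_pow f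
  have h1 : toQq (Polynomial.toLaurent p) = 0 := by rw [hp, map_mul, hf, zero_mul]
  rw [toQq_toLaurent, map_eq_zero_iff _ (RatFunc.algebraMap_injective ℚ),
    Polynomial.map_eq_zero_iff (RingHom.injective_int _)] at h1
  rw [h1, map_zero] at hp
  exact ((LaurentPolynomial.isUnit_T (n : ℤ)).mul_left_eq_zero).1 hp.symm

theorem coeffToOre_eq_algebraMap (a : Zq[X]) :
    coeffToOre a = algebraMap Qq[X] QqQ (a.map toQq) := by
  rw [← RatFunc.aeval_X_left_eq_algebraMap, Polynomial.aeval_def, Polynomial.eval₂_map]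
  rfl

theorem coeffToOre_injective : Function.Injective coeffToOre := by
  intro a b h
  rw [coeffToOre_eq_algebraMap, coeffToOre_eq_algebraMap] at h
  exact Polynomial.map_injective _ toQq_injective (RatFunc.algebraMap_injective _ h)

theorem toOreHom_injective : Function.Injective toOreHom := by
  intro P P' h
  rw [SkewPolynomial.ext_iff]
  intro k
  apply coeffToOre_injective
  rw [← coeff_toOreHom, ← coeff_toOreHom, h]

/-! ### The action on discrete functions -/

theorem act_eq (P : WeylAlgebra) (f : ℕ → Qq) (n : ℕ) : P.act f n =
    SkewMonoidAlgebra.liftNC ((Polynomial.eval₂RingHom toQq (RatFunc.X ^ n) : Zq[X] →+* Qq) :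
      Zq[X] →+ Qq) (fun k : Multiplicative ℕ => f (n + k.toAdd)) P := rfl

theorem act_C_mul (c : Zq[X]) (P : WeylAlgebra) (f : ℕ → Qq) (n : ℕ) :
    WeylAlgebra.act (SkewPolynomial.C c * P) f n =
      c.eval₂ toQq (RatFunc.X ^ n) * P.act f n := by
  rw [act_eq, act_eq]
  induction P using SkewMonoidAlgebra.induction_on with
  | zero => simp
  | single a b =>
    change SkewMonoidAlgebra.liftNC _ _ (SkewMonoidAlgebra.single 1 c * _) = _
    rw [SkewMonoidAlgebra.single_mul_single]
    simp [Polynomial.eval₂_mul, mul_assoc]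
  | add p q hp hq => rw [mul_add, map_add, hp, hq, map_add, mul_add]

theorem X_pow_injective : Function.Injective fun n : ℕ => (RatFunc.X ^ n : Qq) := by
  intro m n h
  have h' : algebraMap ℚ[X] Qq (X ^ m) = algebraMap ℚ[X] Qq (X ^ n) := by simpa using h
  have := congrArg Polynomial.natDegree (RatFunc.algebraMap_injective ℚ h')
  simpa using this

/-- The powers `q ^ n` are distinct, so only finitely many are roots. Denominators are thus
eventually nonzero, and evaluation at `Q = q ^ n` becomes a ring homomorphism to germs. -/
theorem eventually_eval_ne_zero {p : Qq[X]} (hp : p ≠ 0) :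
    ∀ᶠ n : ℕ in Filter.atTop, p.eval (RatFunc.X ^ n) ≠ 0 := by
  classical
  have h : Set.Finite {n : ℕ | p.eval (RatFunc.X ^ n) = 0} := by
    refine Set.Finite.subset (Set.Finite.preimage X_pow_injective.injOn
      (p.roots.toFinset.finite_toSet)) fun n hn => ?_
    simpa [hp] using hn
  rw [← Nat.cofinite_eq_atTop, Filter.eventually_cofinite]
  simpa using h

/-- A rational function of `q` and `Q`, as the germ of the discrete function of its values. -/
def evalGerm : QqQ →+* Filter.Germ (Filter.atTop : Filter ℕ) Qq where
  toFun a := ↑(fun n : ℕ => RatFunc.eval (RingHom.id Qq) (RatFunc.X ^ n) a)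
  map_one' := by simp only [RatFunc.eval_one]; rfl
  map_zero' := by simp only [RatFunc.eval_zero]; rfl
  map_mul' a b := by
    rw [← Filter.Germ.coe_mul, Filter.Germ.coe_eq]
    filter_upwards [eventually_eval_ne_zero (RatFunc.denom_ne_zero a),
      eventually_eval_ne_zero (RatFunc.denom_ne_zero b)] with n h1 h2
    exact RatFunc.eval_mul _ _ h1 h2
  map_add' a b := by
    rw [← Filter.Germ.coe_add, Filter.Germ.coe_eq]
    filter_upwards [eventually_eval_ne_zero (RatFunc.denom_ne_zero a),
      eventually_eval_ne_zero (RatFunc.denom_ne_zero b)] with n h1 h2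
    exact RatFunc.eval_add _ _ h1 h2

theorem evalGerm_apply (a : QqQ) : evalGerm a =
    ↑(fun n : ℕ => RatFunc.eval (RingHom.id Qq) (RatFunc.X ^ n) a) := rfl

/-- The shift of germs of discrete functions. -/
def shiftGerm (k : ℕ) : Filter.Germ (Filter.atTop : Filter ℕ) Qq →+*
    Filter.Germ (Filter.atTop : Filter ℕ) Qq where
  toFun g := g.compTendsto (fun n => n + k) (Filter.tendsto_add_atTop_nat k)
  map_one' := rfl
  map_zero' := rfl
  map_mul' a b := by
    induction a, b using Filter.Germ.inductionOn₂
    rfl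
  map_add' a b := by
    induction a, b using Filter.Germ.inductionOn₂
    rfl

theorem shiftGerm_coe (k : ℕ) (f : ℕ → Qq) :
    shiftGerm k (f : Filter.Germ (Filter.atTop : Filter ℕ) Qq) = ↑(fun n => f (n + k)) := rfl

theorem evalGerm_sigma (a : QqQ) : evalGerm (sigma a) = shiftGerm 1 (evalGerm a) := by
  have : evalGerm.comp sigma = (shiftGerm 1).comp evalGerm := by
    apply IsLocalization.ringHom_ext (nonZeroDivisors Qq[X])
    apply Polynomial.ringHom_ext
    · intro c
      simp only [RingHom.comp_apply, RatFunc.algebraMap_C, sigma_C]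
      simp only [evalGerm_apply, shiftGerm_coe, RatFunc.eval_C]
    · simp only [RingHom.comp_apply, RatFunc.algebraMap_X, sigma_X, map_mul]
      simp only [evalGerm_apply, shiftGerm_coe, RatFunc.eval_C, RatFunc.eval_X,
        ← Filter.Germ.coe_mul]
      congr 1
      ext n
      simp [pow_succ']
  exact congrArg (fun φ => φ a) this

theorem evalGerm_smul (k : Multiplicative ℕ) (a : QqQ) :
    evalGerm (k • a) = shiftGerm k.toAdd (evalGerm a) := by
  rw [smul_QqQ]
  induction k.toAdd with
  | zero => simp [evalGerm_apply, shiftGerm_coe]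
  | succ n ih =>
    rw [pow_succ', RingHom.mul_def, RingHom.comp_apply, evalGerm_sigma, ih]
    simp only [evalGerm_apply, shiftGerm_coe]
    congr 1
    ext m
    rw [add_right_comm, add_assoc]

/-- The action of the Ore algebra on the germ of a discrete function. -/
def oreAct (f : ℕ → Qq) : OreAlgebra →+ Filter.Germ (Filter.atTop : Filter ℕ) Qq :=
  SkewMonoidAlgebra.liftNC (evalGerm : QqQ →+ _) fun k : Multiplicative ℕ =>
    ↑(fun n => f (n + k.toAdd))

theorem oreAct_single (f : ℕ → Qq) (k : Multiplicative ℕ) (a : QqQ) :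
    oreAct f (SkewMonoidAlgebra.single k a) = evalGerm a * ↑(fun n => f (n + k.toAdd)) := by
  simp [oreAct]

theorem oreAct_apply (f : ℕ → Qq) (R : OreAlgebra) : oreAct f R =
    ↑(fun n : ℕ => SkewPolynomial.sum R fun k a =>
      RatFunc.eval (RingHom.id Qq) (RatFunc.X ^ n) a * f (n + k)) := by
  conv_lhs => rw [← SkewMonoidAlgebra.sum_single R]
  rw [SkewMonoidAlgebra.map_sum]
  simp only [oreAct_single, SkewPolynomial.sum_def', SkewMonoidAlgebra.sum_def, Finsupp.sum,
    evalGerm_apply]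
  have h := map_sum (Filter.Germ.coeRingHom (R := Qq) (Filter.atTop : Filter ℕ))
    (fun (a : Multiplicative ℕ) (n : ℕ) => RatFunc.eval (RingHom.id Qq) (RatFunc.X ^ n)
      (SkewMonoidAlgebra.coeff R a) * f (n + a.toAdd)) (SkewMonoidAlgebra.coeff R).support
  refine Eq.trans h.symm ?_
  rw [Filter.Germ.coe_coeRingHom]
  congr 1
  ext n
  simp

theorem mem_oreRecursionIdeal {f : ℕ → Qq} {R : OreAlgebra} :
    R ∈ oreRecursionIdeal f ↔ oreAct f R = 0 := by
  rw [oreAct_apply]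
  exact (Filter.Germ.coe_eq (l := Filter.atTop) (g := fun _ => (0 : Qq))).symm

theorem oreAct_single_mul (f : ℕ → Qq) (k : Multiplicative ℕ) (a : QqQ) (R : OreAlgebra) :
    oreAct f (SkewMonoidAlgebra.single k a * R) =
      evalGerm a * shiftGerm k.toAdd (oreAct f R) := by
  induction R using SkewMonoidAlgebra.induction_on with
  | zero => simp
  | single b r =>
    rw [SkewMonoidAlgebra.single_mul_single, oreAct_single, oreAct_single,
      map_mul evalGerm, map_mul (shiftGerm _), evalGerm_smul, shiftGerm_coe, mul_assoc]
    congr 3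
    ext n
    rw [toAdd_mul, add_assoc]
  | add p q hp hq => rw [mul_add, map_add, hp, hq, map_add, map_add, mul_add]

theorem mul_mem_oreRecursionIdeal {f : ℕ → Qq} (S : OreAlgebra) {R : OreAlgebra}
    (hR : R ∈ oreRecursionIdeal f) : S * R ∈ oreRecursionIdeal f := by
  rw [mem_oreRecursionIdeal] at hR ⊢
  induction S using SkewMonoidAlgebra.induction_on with
  | zero => simp
  | single k a => rw [oreAct_single_mul, hR, map_zero, mul_zero]
  | add p q hp hq => rw [add_mul, map_add, hp, hq, add_zero]

theorem sub_mem_oreRecursionIdeal {f : ℕ → Qq} {R R' : OreAlgebra}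
    (hR : R ∈ oreRecursionIdeal f) (hR' : R' ∈ oreRecursionIdeal f) :
    R - R' ∈ oreRecursionIdeal f := by
  rw [mem_oreRecursionIdeal] at *
  rw [map_sub, hR, hR', sub_zero]

theorem oreAct_toOre (f : ℕ → Qq) (P : WeylAlgebra) :
    oreAct f P.toOre = ↑(fun n : ℕ => P.act f n) := by
  rw [← toOreHom_apply]
  induction P using SkewMonoidAlgebra.induction_on with
  | zero => simp only [map_zero, act_eq]; rfl
  | single k a =>
    rw [toOreHom_single, oreAct_single, evalGerm_apply, ← Filter.Germ.coe_mul]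
    congr 1
    ext n
    rw [act_eq, SkewMonoidAlgebra.liftNC_single, Pi.mul_apply, coeffToOre_eq_algebraMap,
      RatFunc.eval_algebraMap]
    simp [Polynomial.eval_map]
  | add p q hp hq =>
    rw [map_add, map_add, hp, hq, ← Filter.Germ.coe_add]
    congr 1
    ext n
    simp [act_eq]

theorem toOre_mem_oreRecursionIdeal {f : ℕ → Qq} {P : WeylAlgebra} :
    P.toOre ∈ oreRecursionIdeal f ↔ ∀ᶠ n in Filter.atTop, P.act f n = 0 := by
  rw [mem_oreRecursionIdeal, oreAct_toOre]
  exact Filter.Germ.coe_eq (l := Filter.atTop) (g := fun _ => (0 : Qq))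

/-! ### Clearing denominators -/

/-- The embedding of `ℤ[q, Q]` in `ℤ[q, q⁻¹][Q]`. -/
abbrev polyToZq : ℤ[X][X] →+* Zq[X] :=
  Polynomial.mapRingHom (Polynomial.toLaurent : ℤ[X] →+* Zq)

theorem polyToZq_injective : Function.Injective polyToZq :=
  Polynomial.map_injective _ Polynomial.toLaurent_injective

theorem coeffToOre_polyToZq_ne_zero {b : ℤ[X][X]} (hb : b ≠ 0) : coeffToOre (polyToZq b) ≠ 0 :=
  (map_ne_zero_iff _ coeffToOre_injective).2 ((map_ne_zero_iff _ polyToZq_injective).2 hb)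

/-- The rational functions that are quotients of elements of `ℤ[q, Q]`. -/
def integralFractions : Subfield QqQ where
  carrier := {s | ∃ a b : ℤ[X][X], b ≠ 0 ∧ coeffToOre (polyToZq b) * s = coeffToOre (polyToZq a)}
  mul_mem' := by
    rintro s t ⟨a, b, hb, h⟩ ⟨a', b', hb', h'⟩
    refine ⟨a * a', b * b', mul_ne_zero hb hb', ?_⟩
    rw [map_mul, map_mul, map_mul, map_mul, ← h, ← h']
    ring
  one_mem' := ⟨1, 1, one_ne_zero, by simp⟩
  add_mem' := by
    rintro s t ⟨a, b, hb, h⟩ ⟨a', b', hb', h'⟩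
    refine ⟨a * b' + a' * b, b * b', mul_ne_zero hb hb', ?_⟩
    rw [map_mul, map_mul, map_add, map_add, map_mul, map_mul, map_mul, map_mul, ← h, ← h']
    ring
  zero_mem' := ⟨0, 1, one_ne_zero, by simp⟩
  neg_mem' := by
    rintro s ⟨a, b, hb, h⟩
    exact ⟨-a, b, hb, by rw [map_neg, map_neg, ← h, mul_neg]⟩
  inv_mem' := by
    rintro s ⟨a, b, hb, h⟩
    by_cases ha : a = 0
    · refine ⟨0, 1, one_ne_zero, ?_⟩
      rw [ha, map_zero, map_zero, mul_eq_zero] at h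
      rw [h.resolve_left (coeffToOre_polyToZq_ne_zero hb)]
      simp
    · refine ⟨b, a, ha, ?_⟩
      rw [← h, mul_assoc, mul_inv_cancel₀, mul_one]
      rintro rfl
      rw [mul_zero] at h
      exact coeffToOre_polyToZq_ne_zero ha h.symm

theorem subfield_ratFunc_eq_top {k : Type*} [Field k] {F : Subfield (RatFunc k)}
    (hC : ∀ c, RatFunc.C c ∈ F) (hX : RatFunc.X ∈ F) (x : RatFunc k) : x ∈ F := by
  have hp : ∀ p : k[X], algebraMap k[X] (RatFunc k) p ∈ F := fun p => by
    induction p using Polynomial.induction_on' with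
    | add p q hp hq => rw [map_add]; exact F.add_mem hp hq
    | monomial n a =>
      rw [RatFunc.algebraMap_monomial]
      exact F.mul_mem (hC a) (F.pow_mem hX n)
  rw [← RatFunc.num_div_denom x]
  exact F.div_mem (hp _) (hp _)

/-- A subfield with all constants and the variable is everything; this is used for `ℚ(q)` over `ℚ`
and then for `ℚ(q, Q)` over `ℚ(q)`. -/
theorem mem_integralFractions (s : QqQ) : s ∈ integralFractions := by
  refine subfield_ratFunc_eq_top (fun c => ?_) ?_ s
  · have : c ∈ integralFractions.comap RatFunc.C := by
      refine subfield_ratFunc_eq_top (fun r => ?_) ?_ c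
      · rw [eq_ratCast (RatFunc.C : ℚ →+* Qq) r]
        exact SubfieldClass.ratCast_mem _ r
      · exact ⟨C X, 1, one_ne_zero, by simp [coeffToOre, toQq_qpow]⟩
    exact this
  · exact ⟨X, 1, one_ne_zero, by simp [coeffToOre]⟩

/-- The elements of the q-Weyl algebra without negative powers of `q`. -/
def IsPolynomial (P : WeylAlgebra) : Prop :=
  ∀ k, ∃ a, SkewPolynomial.coeff P k = polyToZq a

theorem coeff_skew_C_mul {R : Type*} [Semiring R] [MulSemiringAction (Multiplicative ℕ) R] (a : R)
    (p : SkewPolynomial R) (k : ℕ) :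
    SkewPolynomial.coeff (SkewPolynomial.C a * p) k = a * SkewPolynomial.coeff p k := by
  induction p using SkewMonoidAlgebra.induction_on with
  | zero => simp
  | single b r =>
    change SkewPolynomial.coeff (SkewPolynomial.C a * SkewPolynomial.monomial b.toAdd r) k =
      a * SkewPolynomial.coeff (SkewPolynomial.monomial b.toAdd r) k
    rw [SkewPolynomial.C_mul_monomial, SkewPolynomial.coeff_monomial,
      SkewPolynomial.coeff_monomial, mul_ite, mul_zero]
  | add p q hp hq => rw [mul_add, SkewPolynomial.coeff_add, hp, hq, SkewPolynomial.coeff_add,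
      mul_add]

theorem exists_common_denominator (S : OreAlgebra) : ∃ (b : ℤ[X][X]) (P : WeylAlgebra), b ≠ 0 ∧
    IsPolynomial P ∧ SkewPolynomial.C (coeffToOre (polyToZq b)) * S = toOreHom P := by
  induction S using SkewMonoidAlgebra.induction_on with
  | zero => exact ⟨1, 0, one_ne_zero, fun k => ⟨0, by simp⟩, by simp⟩
  | single k s =>
    obtain ⟨a, b, hb, h⟩ := mem_integralFractions s
    refine ⟨b, SkewPolynomial.monomial k.toAdd (polyToZq a), hb, fun j => ?_, ?_⟩
    · rw [SkewPolynomial.coeff_monomial]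
      split_ifs
      · exact ⟨a, rfl⟩
      · exact ⟨0, by simp⟩
    · refine Eq.trans ?_ (toOreHom_single k (polyToZq a)).symm
      rw [← h]
      exact SkewPolynomial.C_mul_monomial (n := k.toAdd)
  | add S T hS hT =>
    obtain ⟨b, P, hb, hP, h⟩ := hS
    obtain ⟨b', P', hb', hP', h'⟩ := hT
    refine ⟨b * b', SkewPolynomial.C (polyToZq b') * P + SkewPolynomial.C (polyToZq b) * P',
      mul_ne_zero hb hb', fun k => ?_, ?_⟩
    · obtain ⟨a, ha⟩ := hP k
      obtain ⟨a', ha'⟩ := hP' k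
      refine ⟨b' * a + b * a', ?_⟩
      rw [SkewPolynomial.coeff_add, coeff_skew_C_mul, coeff_skew_C_mul, ha, ha', map_add, map_mul,
        map_mul]
    · have hC : ∀ c : Zq[X], toOreHom (SkewPolynomial.C c) = SkewPolynomial.C (coeffToOre c) :=
        fun c => toOreHom_single 1 c
      rw [map_add, map_mul toOreHom, map_mul toOreHom, hC, hC, ← h, ← h',
        mul_add, ← mul_assoc, ← mul_assoc,
        ← SkewPolynomial.C_mul, ← SkewPolynomial.C_mul, map_mul, map_mul, mul_comm]

/-! ### The kernel of the evaluation at `q = 1` -/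

/-- Evaluation at `q = 1` of Laurent polynomials, with integral values. -/
def evalOneInt : Zq →+* ℤ := LaurentPolynomial.eval₂ (RingHom.id ℤ) 1

theorem evalOne_eq (f : Zq) : evalOne f = MvPolynomial.C (evalOneInt f) := by
  induction f using LaurentPolynomial.induction_on' with
  | add p q hp hq => rw [map_add, map_add, hp, hq, map_add]
  | C_mul_T n a =>
    rw [evalOne, evalOneInt, LaurentPolynomial.eval₂_C_mul_T, LaurentPolynomial.eval₂_C_mul_T]
    simp

theorem epsilonCoeff_eq (a : Zq[X]) :
    epsilonCoeff a = Polynomial.aeval (MvPolynomial.X 1) (a.map evalOneInt) := by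
  have : epsilonCoeff = (Polynomial.aeval (MvPolynomial.X 1 : MvPolynomial (Fin 2) ℤ) :
      ℤ[X] →ₐ[ℤ] _).toRingHom.comp (Polynomial.mapRingHom evalOneInt) := by
    apply Polynomial.ringHom_ext
    · intro r
      simp [epsilonCoeff, evalOne_eq]
    · simp [epsilonCoeff]
  exact congrArg (fun φ => φ a) this

theorem evalOneInt_toLaurent (p : ℤ[X]) : evalOneInt (Polynomial.toLaurent p) = p.eval 1 := by
  rw [evalOneInt, LaurentPolynomial.eval₂_toLaurent]
  simp [Polynomial.eval₂_eq_eval_map]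

theorem dvd_of_evalOneInt_eq_zero {f : Zq} (hf : evalOneInt f = 0) : qpow 1 - 1 ∣ f := by
  obtain ⟨n, p, hp⟩ := LaurentPolynomial.exists_T_pow f
  have h1 : p.eval 1 = 0 := by rw [← evalOneInt_toLaurent, hp, map_mul, hf, zero_mul]
  have h2 := map_dvd (Polynomial.toLaurent : ℤ[X] →+* Zq) (dvd_iff_isRoot.2 h1)
  rw [hp, map_sub, Polynomial.toLaurent_X, Polynomial.C_1, map_one] at h2
  exact ((LaurentPolynomial.isUnit_T (n : ℤ)).dvd_mul_right).1 h2

theorem dvd_of_epsilonCoeff_eq_zero {a : Zq[X]} (h : a.map evalOneInt = 0) :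
    C (qpow 1 - 1) ∣ a := by
  rw [Polynomial.C_dvd_iff_dvd_coeff]
  intro i
  apply dvd_of_evalOneInt_eq_zero
  rw [← Polynomial.coeff_map, h, coeff_zero]

/-- Polynomials in `E` and `Q` as polynomials in `E` with coefficients in `ℤ[Q]`. -/
def toBivariate : MvPolynomial (Fin 2) ℤ →ₐ[ℤ] ℤ[X][X] := MvPolynomial.aeval ![X, C X]

theorem toBivariate_aeval (p : ℤ[X]) :
    toBivariate (Polynomial.aeval (MvPolynomial.X 1) p) = C p := by
  have : toBivariate.comp (Polynomial.aeval (MvPolynomial.X 1)) =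
      (Polynomial.CAlgHom : ℤ[X] →ₐ[ℤ] ℤ[X][X]) := by
    apply Polynomial.algHom_ext
    simp [toBivariate]
  exact congrArg (fun φ => φ p) this

theorem coeff_toBivariate_epsilon (P : WeylAlgebra) (k : ℕ) :
    (toBivariate P.epsilon).coeff k = (SkewPolynomial.coeff P k).map evalOneInt := by
  have hX : toBivariate (MvPolynomial.X 0) = X := by simp [toBivariate]
  rw [epsilon_eq_sum, map_sum, Polynomial.finsetSum_coeff]
  simp only [map_mul, map_pow, hX, epsilonCoeff_eq, toBivariate_aeval, coeff_C_mul, coeff_X_pow,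
    mul_ite, mul_one, mul_zero]
  rw [Finset.sum_ite_eq]
  split_ifs with h
  · rfl
  · rw [SkewPolynomial.notMem_support_iff.1 h, Polynomial.map_zero]

theorem map_evalOneInt_coeff_eq_zero {P : WeylAlgebra} (h : P.epsilon = 0) (k : ℕ) :
    (SkewPolynomial.coeff P k).map evalOneInt = 0 := by
  rw [← coeff_toBivariate_epsilon, h, map_zero, coeff_zero]

/-- The powers of `E` stay independent at `q = 1`, so every coefficient vanishes there and is
divisible by `q - 1`. -/
theorem exists_eq_C_mul_of_epsilon_eq_zero {P : WeylAlgebra} (h : P.epsilon = 0) :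
    ∃ P', P = SkewPolynomial.C (C (qpow 1 - 1)) * P' := by
  choose a ha using fun k => dvd_of_epsilonCoeff_eq_zero (map_evalOneInt_coeff_eq_zero h k)
  refine ⟨∑ k ∈ SkewPolynomial.support P, SkewPolynomial.monomial k (a k), ?_⟩
  conv_lhs => rw [← SkewPolynomial.sum_monomial P]
  rw [SkewPolynomial.sum_def, Finset.mul_sum]
  refine Finset.sum_congr rfl fun k _ => ?_
  rw [SkewPolynomial.C_mul_monomial, ← ha k]

theorem C_mul_skew_injective {u : Zq[X]} (hu : u ≠ 0) {P P' : WeylAlgebra}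
    (h : SkewPolynomial.C u * P = SkewPolynomial.C u * P') : P = P' := by
  rw [SkewPolynomial.ext_iff]
  intro k
  have := congrArg (fun R => SkewPolynomial.coeff R k) h
  simp only [coeff_skew_C_mul] at this
  exact mul_left_cancel₀ hu this

theorem qpow_sub_one_ne_zero : (C (qpow 1 - 1) : Zq[X]) ≠ 0 := by
  rw [Ne, Polynomial.C_eq_zero, sub_eq_zero]
  intro h
  have := congrArg toQq h
  rw [toQq_qpow, map_one, zpow_one] at this
  have h2 := X_pow_injective (a₁ := 1) (a₂ := 0) (by simpa using this)
  omega

/-- At `q = 1` the left side vanishes. As `ℤ[E, Q]` is a domain and `ε P ≠ 0`, the factor `S` is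
divisible by `q - 1`, which cancels; this is repeated `n` times. -/
theorem exists_cancel_pow {P R : WeylAlgebra} (hP : P.epsilon ≠ 0) (b : Zq[X]) (n : ℕ)
    (S : WeylAlgebra) (h : SkewPolynomial.C (C (qpow 1 - 1) ^ n * b) * R = S * P) :
    ∃ S' : WeylAlgebra, SkewPolynomial.C b * R = S' * P := by
  induction n generalizing S with
  | zero => exact ⟨S, by simpa using h⟩
  | succ n ih =>
    have h1 := congrArg epsilonHom h
    rw [map_mul epsilonHom, map_mul epsilonHom, epsilonHom_C, epsilonCoeff_eq,
      Polynomial.map_mul, Polynomial.map_pow,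
      Polynomial.map_C, map_sub, map_one, show evalOneInt (qpow 1) = 1 by simp [evalOneInt],
      sub_self, C_0, zero_pow (Nat.succ_ne_zero n), zero_mul, map_zero, zero_mul,
      epsilonHom_apply, epsilonHom_apply] at h1
    obtain ⟨S', rfl⟩ :=
      exists_eq_C_mul_of_epsilon_eq_zero ((mul_eq_zero.1 h1.symm).resolve_right hP)
    refine ih S' (C_mul_skew_injective qpow_sub_one_ne_zero ?_)
    rw [← mul_assoc, ← SkewPolynomial.C_mul, ← mul_assoc, ← pow_succ', h, mul_assoc]

theorem isUnit_C_X_sub_one : ¬ IsUnit (C (X - 1) : ℤ[X][X]) := by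
  rw [Polynomial.isUnit_C, ← C_1]
  exact (Polynomial.irreducible_X_sub_C (1 : ℤ)).not_isUnit

theorem C_X_sub_one_dvd {b : ℤ[X][X]} (h : (polyToZq b).map evalOneInt = 0) : C (X - 1) ∣ b := by
  rw [Polynomial.C_dvd_iff_dvd_coeff]
  intro i
  have := congrArg (fun p => Polynomial.coeff p i) h
  rw [← C_1, dvd_iff_isRoot, IsRoot, ← evalOneInt_toLaurent]
  simpa using this

theorem exists_mul_epsilon_eq {P R : WeylAlgebra} {S : OreAlgebra} (hP : P.epsilon ≠ 0)
    (h : R.toOre = S * P.toOre) :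
    ∃ c : ℤ[X], c ≠ 0 ∧ P.epsilon ∣ Polynomial.aeval (MvPolynomial.X 1) c * R.epsilon := by
  obtain ⟨b, S', hb, -, hS⟩ := exists_common_denominator S
  -- All powers of `q - 1` are split off the denominator, so that `b'` stays nonzero at `q = 1` and
  -- supplies `c`.
  obtain ⟨n, b', hb', rfl⟩ := WfDvdMonoid.max_power_factor' hb isUnit_C_X_sub_one
  have h1 : SkewPolynomial.C (polyToZq (C (X - 1) ^ n * b')) * R = S' * P := by
    apply toOreHom_injective
    rw [map_mul toOreHom, map_mul toOreHom, ← hS, toOreHom_apply R, toOreHom_apply P, h, mul_assoc]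
    congr 1
    exact toOreHom_single 1 _
  rw [map_mul, map_pow, show polyToZq (C (X - 1)) = C (qpow 1 - 1) by simp] at h1
  obtain ⟨S'', h2⟩ := exists_cancel_pow hP _ n S' h1
  refine ⟨(polyToZq b').map evalOneInt, fun h0 => hb' (C_X_sub_one_dvd h0),
    S''.epsilon, ?_⟩
  have h3 := congrArg epsilonHom h2
  rw [map_mul epsilonHom, map_mul epsilonHom, epsilonHom_C, epsilonCoeff_eq] at h3
  rw [← epsilonHom_apply, h3, mul_comm]
  rfl

/-- Otherwise `q - 1` would be a common divisor of the coprime coefficients. -/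
theorem IsAqPolynomial.epsilon_ne_zero {I : Set OreAlgebra} {P : WeylAlgebra}
    (h : IsAqPolynomial I P) (hP : P ≠ 0) : P.epsilon ≠ 0 := by
  intro h0
  obtain ⟨-, a, ha, hcop⟩ := h
  refine isUnit_C_X_sub_one (hcop hP _ fun k => C_X_sub_one_dvd ?_)
  have := map_evalOneInt_coeff_eq_zero h0 k
  rwa [show SkewPolynomial.coeff P k = polyToZq (a k) from ha k] at this

/-! ### The characteristic variety -/

theorem toOre_mem_of_mem_recursionIdeal {f : ℕ → Qq} {R : WeylAlgebra}
    (hR : R ∈ recursionIdeal f) : R.toOre ∈ oreRecursionIdeal f :=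
  toOre_mem_oreRecursionIdeal.2 (Filter.eventually_atTop.2 ⟨1, hR⟩)

/-- The ideal generated by `I` is finitely generated, and the product of the multipliers of the
generators serves for all its elements. -/
theorem exists_common_multiplier {I : Set (MvPolynomial (Fin 2) ℤ)} {g : MvPolynomial (Fin 2) ℤ}
    (h : ∀ x ∈ I, ∃ c : ℤ[X], c ≠ 0 ∧ g ∣ Polynomial.aeval (MvPolynomial.X 1) c * x) :
    ∃ c : ℤ[X], c ≠ 0 ∧ ∀ x ∈ I, g ∣ Polynomial.aeval (MvPolynomial.X 1) c * x := by
  have hspan : ∀ x ∈ Ideal.span I,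
      ∃ c : ℤ[X], c ≠ 0 ∧ g ∣ Polynomial.aeval (MvPolynomial.X 1) c * x := by
    intro x hx
    induction hx using Submodule.span_induction with
    | mem x hx => exact h x hx
    | zero => exact ⟨1, one_ne_zero, by simp⟩
    | add x y _ _ hx hy =>
      obtain ⟨c, hc, u, hu⟩ := hx
      obtain ⟨d, hd, v, hv⟩ := hy
      refine ⟨c * d, mul_ne_zero hc hd, Polynomial.aeval (MvPolynomial.X 1) d * u +
        Polynomial.aeval (MvPolynomial.X 1) c * v, ?_⟩
      rw [map_mul]
      linear_combination Polynomial.aeval (MvPolynomial.X 1) d * hu +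
        Polynomial.aeval (MvPolynomial.X 1) c * hv
    | smul a x _ hx =>
      obtain ⟨c, hc, u, hu⟩ := hx
      exact ⟨c, hc, a * u, by rw [smul_eq_mul]; linear_combination a * hu⟩
  obtain ⟨s, hs⟩ := (isNoetherianRing_iff_ideal_fg _).1 inferInstance (Ideal.span I)
  choose! c hc hd using hspan
  have hmem : ∀ x ∈ s, x ∈ Ideal.span I := fun x hx => hs ▸ Ideal.subset_span hx
  refine ⟨∏ x ∈ s, c x, Finset.prod_ne_zero_iff.2 fun x hx => hc x (hmem x hx), fun x hx => ?_⟩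
  have hx' : x ∈ Ideal.span (s : Set (MvPolynomial (Fin 2) ℤ)) := hs ▸ Ideal.subset_span hx
  clear hx
  induction hx' using Submodule.span_induction with
  | mem x hx =>
    refine (hd x (hmem x hx)).trans (mul_dvd_mul_right ?_ x)
    exact _root_.map_dvd (Polynomial.aeval _) (Finset.dvd_prod_of_mem c hx)
  | zero => simp
  | add x y _ _ hx hy => rw [mul_add]; exact dvd_add hx hy
  | smul a x _ hx => rw [smul_eq_mul, mul_left_comm]; exact hx.mul_left a

theorem exists_multiplier_mem_recursionIdeal {f : ℕ → Qq} {P : WeylAlgebra}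
    (hP : P.toOre ∈ oreRecursionIdeal f) :
    ∃ R ∈ recursionIdeal f, ∃ N : ℕ,
      R.epsilon = Polynomial.aeval (MvPolynomial.X 1) ((X - 1 : ℤ[X]) ^ N) * P.epsilon := by
  obtain ⟨N, hN⟩ := Filter.eventually_atTop.1 (toOre_mem_oreRecursionIdeal.1 hP)
  -- For `n < N` the factor with `j = n` vanishes at `Q = q ^ n`; at `q = 1` every factor becomes `Q
  -- - 1`.
  refine ⟨SkewPolynomial.C (∏ j ∈ Finset.range N, (X - C (qpow j))) * P, fun n _ => ?_, N, ?_⟩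
  · rw [act_C_mul]
    by_cases hn : N ≤ n
    · rw [hN n hn, mul_zero]
    · rw [Polynomial.eval₂_finsetProd,
        Finset.prod_eq_zero (Finset.mem_range.2 (not_le.1 hn)), zero_mul]
      simp [toQq_qpow]
  · rw [← epsilonHom_apply, map_mul, epsilonHom_C, epsilonCoeff_eq, Polynomial.map_prod]
    simp [evalOneInt, LaurentPolynomial.eval₂_T, epsilonHom_apply]

theorem essentiallyEqual_characteristicVariety {f : ℕ → Qq} {P : WeylAlgebra}
    (h : IsAqPolynomial (oreRecursionIdeal f) P) :
    EssentiallyEqual (characteristicVariety (recursionIdeal f)) (zeros P.epsilon ∩ torus) := by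
  -- If `P = 0`, the recursion ideal contains only `0`, and both sets are the whole torus.
  by_cases hP : P = 0
  · have h1 : ∀ R ∈ recursionIdeal f, R = 0 := fun R hR => by
      obtain ⟨S, hS⟩ := (h.1 _).1 (toOre_mem_of_mem_recursionIdeal hR)
      apply toOreHom_injective
      rw [toOreHom_apply, hS, hP, ← toOreHom_apply, map_zero, mul_zero]
    have h2 : characteristicVariety (recursionIdeal f) = zeros P.epsilon ∩ torus := by
      ext p
      refine ⟨fun hp => ⟨?_, hp.1⟩, fun hp => ⟨hp.2, fun R hR => ?_⟩⟩
      · rw [hP, zeros, Set.mem_ofPred_eq, ← epsilonHom_apply, map_zero, map_zero]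
      · rw [h1 R hR, ← epsilonHom_apply, map_zero, map_zero]
    rw [h2]
    exact ⟨∅, ∅, rfl⟩
  · have hε := h.epsilon_ne_zero hP
    obtain ⟨c, hc, hdvd⟩ := exists_common_multiplier (I := WeylAlgebra.epsilon '' recursionIdeal f)
      (g := P.epsilon) (by
        rintro _ ⟨R, hR, rfl⟩
        obtain ⟨S, hS⟩ := (h.1 _).1 (toOre_mem_of_mem_recursionIdeal hR)
        exact exists_mul_epsilon_eq hε hS)
    obtain ⟨R, hR, N, hN⟩ := exists_multiplier_mem_recursionIdeal ((h.1 _).2 ⟨1, (one_mul _).symm⟩)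
    have hX : ((X - 1 : ℤ[X]) ^ N) ≠ 0 := pow_ne_zero _ (by
      rw [← C_1]; exact X_sub_C_ne_zero 1)
    refine essentiallyEqual_of_agree (map_int_ne_zero (mul_ne_zero hc hX)) fun p hp => ?_
    rw [Polynomial.map_mul, Polynomial.eval_mul, ← aeval_aeval_X_int, ← aeval_aeval_X_int] at hp
    constructor
    · rintro ⟨hT, hp'⟩
      have h1 := hp' R hR
      rw [hN, map_mul] at h1
      exact ⟨(mul_eq_zero.1 h1).resolve_left (right_ne_zero_of_mul hp), hT⟩
    · rintro ⟨hz, hT⟩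
      refine ⟨hT, fun R' hR' => ?_⟩
      obtain ⟨s, hs⟩ := hdvd _ ⟨R', hR', rfl⟩
      have h1 := congrArg (MvPolynomial.aeval p) hs
      rw [map_mul, map_mul, show MvPolynomial.aeval p P.epsilon = 0 from hz, zero_mul] at h1
      exact (mul_eq_zero.1 h1).resolve_left (left_ne_zero_of_mul hp)

/-! ### Existence of an `A_q`-polynomial -/

theorem coeff_skew_monomial_mul {R : Type*} [Semiring R] [MulSemiringAction (Multiplicative ℕ) R]
    (m : ℕ) (r : R) (p : SkewPolynomial R) (j : ℕ) :
    SkewPolynomial.coeff (SkewPolynomial.monomial m r * p) (m + j) =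
      r * (Multiplicative.ofAdd m • SkewPolynomial.coeff p j) := by
  induction p using SkewMonoidAlgebra.induction_on with
  | zero => simp
  | single b s =>
    change SkewPolynomial.coeff (SkewPolynomial.monomial m r *
      SkewPolynomial.monomial b.toAdd s) (m + j) =
      r * (Multiplicative.ofAdd m • SkewPolynomial.coeff (SkewPolynomial.monomial b.toAdd s) j)
    rw [SkewPolynomial.monomial_mul_monomial, SkewPolynomial.coeff_monomial,
      SkewPolynomial.coeff_monomial, SkewPolynomial.φ_iterate_apply]
    simp only [add_right_inj]
    split_ifs <;> simp
  | add p q hp hq =>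
    rw [mul_add, SkewPolynomial.coeff_add, hp, hq, SkewPolynomial.coeff_add, smul_add, mul_add]

theorem smul_QqQ_ne_zero (k : Multiplicative ℕ) {a : QqQ} (ha : a ≠ 0) : k • a ≠ 0 := by
  rw [smul_QqQ]
  exact (map_ne_zero_iff _ (sigma ^ k.toAdd).injective).2 ha

theorem exists_coeff_eq_zero {R : Type*} [Semiring R] (p : SkewPolynomial R) :
    ∃ n, ∀ k, n ≤ k → SkewPolynomial.coeff p k = 0 := by
  refine ⟨(SkewPolynomial.support p).sup id + 1, fun k hk => ?_⟩
  rw [← SkewPolynomial.notMem_support_iff]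
  intro h
  have : k ≤ (SkewPolynomial.support p).sup id := Finset.le_sup (f := id) h
  omega

/-- This is right division by `R₀`, by induction on a strict bound for the degree in `E`; minimality
forces the remainder to vanish. -/
theorem exists_eq_mul_of_minimal {f : ℕ → Qq} {R₀ : OreAlgebra} {d : ℕ}
    (hR₀ : R₀ ∈ oreRecursionIdeal f) (hd : SkewPolynomial.coeff R₀ d ≠ 0)
    (htop : ∀ k, d + 1 ≤ k → SkewPolynomial.coeff R₀ k = 0)
    (hmin : ∀ R ∈ oreRecursionIdeal f, (∀ k, d ≤ k → SkewPolynomial.coeff R k = 0) → R = 0)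
    (n : ℕ) (R : OreAlgebra) (hR : R ∈ oreRecursionIdeal f)
    (hn : ∀ k, n ≤ k → SkewPolynomial.coeff R k = 0) : ∃ S : OreAlgebra, R = S * R₀ := by
  induction n generalizing R with
  | zero => exact ⟨0, by rw [zero_mul, hmin R hR fun k _ => hn k (Nat.zero_le k)]⟩
  | succ n ih =>
    rcases Nat.lt_or_ge n d with h | h
    · exact ⟨0, by rw [zero_mul, hmin R hR fun k hk => hn k (by omega)]⟩
    · obtain ⟨m, rfl⟩ := Nat.exists_eq_add_of_le' h
      -- Moving `E ^ m` past the leading coefficient of `R₀` applies `σ ^ m` to it, so the twisted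
      -- coefficient has to be inverted.
      set c := SkewPolynomial.coeff R (m + d) *
        (Multiplicative.ofAdd m • SkewPolynomial.coeff R₀ d)⁻¹ with hc
      obtain ⟨S, hS⟩ := ih (R - SkewPolynomial.monomial m c * R₀)
        (sub_mem_oreRecursionIdeal hR (mul_mem_oreRecursionIdeal _ hR₀)) fun k hk => by
          obtain ⟨j, rfl⟩ := Nat.exists_eq_add_of_le (show m ≤ k by omega)
          rw [SkewPolynomial.coeff_sub, coeff_skew_monomial_mul]
          rcases (show d ≤ j by omega).eq_or_lt with rfl | hj
          · rw [hc, inv_mul_cancel_right₀ (smul_QqQ_ne_zero _ hd), sub_self]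
          · rw [hn _ (by omega), htop j hj, smul_zero, mul_zero, sub_zero]
      exact ⟨S + SkewPolynomial.monomial m c, by rw [add_mul, ← hS, sub_add_cancel]⟩

theorem exists_generator_oreRecursionIdeal (f : ℕ → Qq) :
    ∃ R₀ : OreAlgebra, ∀ R, R ∈ oreRecursionIdeal f ↔ ∃ S : OreAlgebra, R = S * R₀ := by
  classical
  by_cases h : ∃ R ∈ oreRecursionIdeal f, R ≠ 0
  · have hex : ∃ n, ∃ R ∈ oreRecursionIdeal f, R ≠ 0 ∧
        ∀ k, n ≤ k → SkewPolynomial.coeff R k = 0 := by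
      obtain ⟨R, hR, hR0⟩ := h
      obtain ⟨n, hn⟩ := exists_coeff_eq_zero R
      exact ⟨n, R, hR, hR0, hn⟩
    obtain ⟨R₀, hR₀, h0, htop⟩ := Nat.find_spec hex
    have hmin := fun m (hm : m < Nat.find hex) => Nat.find_min hex hm
    generalize Nat.find hex = N at htop hmin
    -- `N` is a strict bound on the degree, so the degree is `d = N - 1`, and `N = 0` would mean `R₀
    -- = 0`.
    obtain _ | d := N
    · exact absurd (SkewPolynomial.ext fun k => htop k (Nat.zero_le k)) h0
    have hmin' : ∀ R ∈ oreRecursionIdeal f,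
        (∀ k, d ≤ k → SkewPolynomial.coeff R k = 0) → R = 0 := fun R hR hk => by
      by_contra hne
      exact hmin d (Nat.lt_succ_self d) ⟨R, hR, hne, hk⟩
    have hd : SkewPolynomial.coeff R₀ d ≠ 0 := fun hd => h0 (hmin' R₀ hR₀ fun k hk => by
      rcases hk.eq_or_lt with rfl | hk
      · exact hd
      · exact htop k hk)
    refine ⟨R₀, fun R => ⟨fun hR => ?_, ?_⟩⟩
    · obtain ⟨n, hn⟩ := exists_coeff_eq_zero R
      exact exists_eq_mul_of_minimal hR₀ hd htop hmin' n R hR hn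
    · rintro ⟨S, rfl⟩
      exact mul_mem_oreRecursionIdeal S hR₀
  · push Not at h
    refine ⟨0, fun R => ⟨fun hR => ⟨0, by rw [h R hR, zero_mul]⟩, ?_⟩⟩
    rintro ⟨S, rfl⟩
    rw [mul_zero, mem_oreRecursionIdeal, map_zero]

theorem exists_primitive_part {P : WeylAlgebra} (hP : IsPolynomial P) (h0 : P ≠ 0) :
    ∃ (d : ℤ[X][X]) (P' : WeylAlgebra) (a : ℕ → ℤ[X][X]), d ≠ 0 ∧
      P = SkewPolynomial.C (polyToZq d) * P' ∧
      (∀ k, SkewPolynomial.coeff P' k = polyToZq (a k)) ∧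
      ∀ e : ℤ[X][X], (∀ k, e ∣ a k) → IsUnit e := by
  classical
  let := UniqueFactorizationMonoid.strongNormalizationMonoid (α := ℤ[X][X])
  let := UniqueFactorizationMonoid.toNormalizedGCDMonoid ℤ[X][X]
  choose a ha using hP
  have hne : (SkewPolynomial.support P).Nonempty := by
    rw [Finset.nonempty_iff_ne_empty, Ne, SkewPolynomial.support_eq_empty]
    exact h0
  obtain ⟨g, hg, hg1⟩ := Finset.extract_gcd a hne
  have hd : (SkewPolynomial.support P).gcd a ≠ 0 := fun hd => by
    obtain ⟨k, hk⟩ := hne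
    refine SkewPolynomial.mem_support_iff.1 hk ?_
    rw [ha, hg k hk, hd, zero_mul, map_zero]
  -- The cofactors `g` are unspecified outside the support, hence the cutoff.
  have hcoeff : ∀ k, SkewPolynomial.coeff (∑ j ∈ SkewPolynomial.support P,
      SkewPolynomial.monomial j (polyToZq (g j)) : WeylAlgebra) k =
      polyToZq (if k ∈ SkewPolynomial.support P then g k else 0) := fun k => by
    have hsum : ∀ s : Finset ℕ, SkewPolynomial.coeff (∑ j ∈ s,
        SkewPolynomial.monomial j (polyToZq (g j)) : WeylAlgebra) k =
        ∑ j ∈ s, if j = k then polyToZq (g j) else 0 := fun s => by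
      induction s using Finset.induction_on with
      | empty => simp
      | insert j s hj ih =>
        rw [Finset.sum_insert hj, Finset.sum_insert hj, SkewPolynomial.coeff_add, ih,
          SkewPolynomial.coeff_monomial]
    rw [hsum, Finset.sum_ite_eq']
    split_ifs
    · rfl
    · rw [map_zero]
  refine ⟨_, _, _, hd, ?_, hcoeff, fun e he => ?_⟩
  · refine SkewPolynomial.ext fun k => ?_
    rw [coeff_skew_C_mul, hcoeff, ← map_mul]
    split_ifs with hk
    · rw [ha, hg k hk]
    · rw [mul_zero, map_zero, SkewPolynomial.notMem_support_iff.1 hk]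
  · refine isUnit_of_dvd_one (hg1 ▸ Finset.dvd_gcd fun k hk => ?_)
    simpa only [if_pos hk] using he k

theorem skew_C_mul_C_inv {a : QqQ} (ha : a ≠ 0) :
    (SkewPolynomial.C a⁻¹ * SkewPolynomial.C a : OreAlgebra) = 1 := by
  rw [← SkewPolynomial.C_mul, inv_mul_cancel₀ ha]
  rfl

/-- Clearing denominators and dividing out the content multiply a generator on the left by units of
`ℚ(q, Q)`, which does not change the left ideal. -/
theorem exists_isAqPolynomial (f : ℕ → Qq) : ∃ P, IsAqPolynomial (oreRecursionIdeal f) P := by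
  obtain ⟨R₀, hgen⟩ := exists_generator_oreRecursionIdeal f
  obtain ⟨b, P, hb, hP, h⟩ := exists_common_denominator R₀
  have hb' := skew_C_mul_C_inv (coeffToOre_polyToZq_ne_zero hb)
  have hR₀ : R₀ = SkewPolynomial.C (coeffToOre (polyToZq b))⁻¹ * toOreHom P := by
    rw [← h, ← mul_assoc, hb', one_mul]
  by_cases h0 : P = 0
  · refine ⟨0, fun R => ?_, 0, fun k => by simp, fun h => absurd rfl h⟩
    rw [hgen, hR₀, h0, ← toOreHom_apply, map_zero, mul_zero]
  · obtain ⟨d, P', a, hd, hPP', ha, hcop⟩ := exists_primitive_part hP h0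
    have hd' := skew_C_mul_C_inv (coeffToOre_polyToZq_ne_zero hd)
    have hP1 : toOreHom P = SkewPolynomial.C (coeffToOre (polyToZq d)) * toOreHom P' := by
      rw [hPP', map_mul toOreHom]
      congr 1
      exact toOreHom_single 1 _
    refine ⟨P', fun R => ?_, a, ha, fun _ => hcop⟩
    rw [hgen, ← toOreHom_apply]
    constructor
    · rintro ⟨S, rfl⟩
      exact ⟨S * (SkewPolynomial.C (coeffToOre (polyToZq b))⁻¹ *
        SkewPolynomial.C (coeffToOre (polyToZq d))), by rw [hR₀, hP1]; simp only [mul_assoc]⟩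
    · rintro ⟨S, rfl⟩
      refine ⟨S * (SkewPolynomial.C (coeffToOre (polyToZq d))⁻¹ *
        SkewPolynomial.C (coeffToOre (polyToZq b))), ?_⟩
      rw [mul_assoc, mul_assoc, h, hP1, ← mul_assoc (SkewPolynomial.C _⁻¹), hd', one_mul]

/-! ### The two conjectures -/

theorem AJFor.charEqDefFor {K : Knot} (h : AJFor K) : CharEqDefFor K := by
  obtain ⟨A, hA⟩ := K.exists_isAPolynomial
  obtain ⟨P, hP⟩ := exists_isAqPolynomial (coloredJones K)
  exact (essentiallyEqual_characteristicVariety hP).trans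
    (essentiallyEqual_deformationVarietySq hA (h A P hA hP))

end AJ

end

theorem mainTheorem2 :
    (AJ.AJConjecture → AJ.CharEqDefConjecture) ∧
    (∀ K : AJ.Knot, AJ.AJFor K → AJ.CharEqDefFor K) ∧
    (∀ (K : AJ.Knot) (P : AJ.WeylAlgebra), K.IsAqPolynomial P →
      AJ.EssentiallyEqual K.charVariety (AJ.zeros P.epsilon ∩ AJ.torus)) ∧
    (∀ (K : AJ.Knot) (A : MvPolynomial (Fin 2) ℤ), K.IsAPolynomial A →
      AJ.EssentiallyEqual K.deformationVariety (AJ.zeros A)) ∧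
    (∀ f g : MvPolynomial (Fin 2) ℤ, AJ.EssentiallyEqualPoly f g →
      AJ.EssentiallyEqual (AJ.zeros f) (AJ.zeros g)) := by
  exact ⟨fun h K => (h K).charEqDefFor, fun _ h => h.charEqDefFor,
    fun _ _ h => AJ.essentiallyEqual_characteristicVariety h, fun _ _ h => h.essentiallyEqual,
    fun _ _ h => AJ.essentiallyEqual_zeros h⟩
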